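/- **Definitions.** For $p\in[1,\infty)$ and measurable $F$ on $\mathbb{R}$ (complex-valued or $[0,\infty]$-valued) let $$\|F\|_{S^p}=\Big(\sup_{x\in\mathbb{R}}\int_x^{x+1}|F(s)|^p\,ds\Big)^{1/p}\in[0,\infty].$$ The Stepanov space $S^p$ consists of the measurable functions $f:\mathbb{R}\to\mathbb{C}$ (modulo equality a.e.) that are limits in $\|\cdot\|_{S^p}$ of trigonometric polynomials $\sum_{n=1}^N c_n e^{i\lambda_n x}$ with $c_n\in\mathbb{C}$, $\lambda_n\in\mathbb{R}$. For $f\in S^p$ and $\lambda\in\mathbb{R}$ put $$\widehat f(\lambda)=\lim_{T\to\infty}\frac1{2T}\int_{-T}^T f(x)e^{-i\lambda x}\,dx .$$ The symmetrised set of Fourier exponents of $f$ is $\Lambda_f=\{\lambda\in\mathbb{R}:\widehat f(\lambda)\ne0\text{ or }\widehat f(-\lambda)\neq0\}$, and $f$ satisfies the separation condition with constant $\alpha>0$ if $|\lambda-\mu|>\alpha$ for all distinct $\lambda,\mu\in\Lambda_f$. Let $\operatorname{sgn}_+(\lambda)=1$ for $\lambda\ge0$ and $-1$ for $\lambda<0$;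 let $\operatorname{sgn}_-(\lambda)=1$ for $\lambda>0$ and $-1$ for $\lambda\le0$. The modified Hilbert transform $H_\pm f$ of $f\in S^p$ is the element of $S^p$ with $\widehat{H_\pm f}(\lambda)=-i\operatorname{sgn}_\pm(\lambda)\widehat f(\lambda)$ for all $\lambda\in\mathbb{R}$, whenever such an element exists. **Theorem.** Let $k\ge1$ be an integer and $\alpha>0$. There is a constant $C=C(k,\alpha)<\infty$ such that for every sequence $(f_j)_{j\in\mathbb{N}}$ in $S^{2^k}$ whose members all satisfy the separation condition with the constant $\alpha$, and for either choice of sign, each $H_\pm f_j$ exists in $S^{2^k}$, is unique up to equality a.e., and $$\Big\|\Big(\sum_{j\in\mathbb{N}}|H_\pm f_j|^2\Big)^{1/2}\Big\|_{S^{2^k}}\le C\,\Big\|\Big(\sum_{j\in\mathbb{N}}|f_j|^2\Big)^{1/2}\Big\|_{S^{2^k}}$$ (the right-hand side may be infinite). -/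

import Mathlib

open Filter Topology MeasureTheory
open scoped ENNReal NNReal

namespace Stepanov

/-- The Stepanov norm `(sup_x ∫_x^{x+1} |f(s)|^p ds)^{1/p}`, with values in `[0, ∞]`.  It is
applied to complex functions and to `[0, ∞]`-valued ones (where `‖·‖ₑ` is the identity). -/
noncomputable def stepNorm {E : Type*} [ENorm E] (p : ℝ) (f : ℝ → E) : ℝ≥0∞ :=
  (⨆ x : ℝ, ∫⁻ s in Set.Icc x (x + 1), ‖f s‖ₑ ^ p) ^ (1 / p)

/-- Trigonometric polynomials: finite sums `∑ c_ξ e^{iξx}` with real frequencies `ξ`. -/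
def IsTrigPoly (P : ℝ → ℂ) : Prop :=
  ∃ (s : Finset ℝ) (c : ℝ → ℂ), ∀ x : ℝ, P x = ∑ ξ ∈ s, c ξ * Complex.exp (Complex.I * ξ * x)

/-- The Stepanov space `S^p`: the completion of the trigonometric polynomials in the Stepanov
norm, realised as the (a.e. classes of) measurable functions on `ℝ` that are limits in this norm
of trigonometric polynomials. -/
def Mem (p : ℝ) (f : ℝ → ℂ) : Prop :=
  AEStronglyMeasurable f volume ∧
    ∀ ε : ℝ≥0∞, 0 < ε → ∃ P : ℝ → ℂ, IsTrigPoly P ∧ stepNorm p (f - P) < ε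

/-- The Fourier coefficient `lim_{T → ∞} (1 / 2T) ∫_{-T}^T f(x) e^{-iξx} dx`.  The limit exists for
every `f` in a Stepanov space `S^p`, `p ≥ 1`. -/
noncomputable def fourierCoeff (f : ℝ → ℂ) (ξ : ℝ) : ℂ :=
  limUnder atTop (fun T : ℝ =>
    (1 / (2 * T) : ℂ) * ∫ x in (-T)..T, f x * Complex.exp (-(Complex.I * ξ * x)))

/-- The Fourier exponents of `f`, symmetrised about the origin: `ξ` is an exponent if at least
one of the coefficients at `ξ` and `-ξ` is nonzero. -/
def exponents (f : ℝ → ℂ) : Set ℝ :=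
  {ξ | fourierCoeff f ξ ≠ 0 ∨ fourierCoeff f (-ξ) ≠ 0}

/-- The separation condition with constant `α`: distinct exponents differ by more than `α`.
(When the exponents are listed in increasing order this says that consecutive ones do.) -/
def Separated (α : ℝ) (f : ℝ → ℂ) : Prop :=
  ∀ ξ ∈ exponents f, ∀ η ∈ exponents f, ξ < η → α < η - ξ

/-- `sgn₊`, equal to `1` on `[0, ∞)` and to `-1` on `(-∞, 0)`. -/
noncomputable def sgnPlus (x : ℝ) : ℝ := if 0 ≤ x then 1 else -1

/-- `sgn₋`, equal to `1` on `(0, ∞)` and to `-1` on `(-∞, 0]`. -/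
noncomputable def sgnMinus (x : ℝ) : ℝ := if 0 < x then 1 else -1

/-- `g = H f` in `S^p`, where `H` is the modified Hilbert transform with sign function `σ`:
`g` is the element of `S^p` with Fourier coefficients `-i σ(ξ) f̂(ξ)`, `ξ ∈ ℝ`. -/
def IsHilbertTransform (σ : ℝ → ℝ) (p : ℝ) (f g : ℝ → ℂ) : Prop :=
  Mem p g ∧ ∀ ξ : ℝ, fourierCoeff g ξ = -Complex.I * (σ ξ : ℂ) * fourierCoeff f ξ

/-- The square function `(∑_j |f_j|²)^{1/2}`, with values in `[0, ∞]`. -/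
noncomputable def squareFn (f : ℕ → ℝ → ℂ) (x : ℝ) : ℝ≥0∞ :=
  (∑' j : ℕ, ‖f j x‖ₑ ^ (2 : ℝ)) ^ (1 / 2 : ℝ)

end Stepanov

/-! This is M. Riesz's argument for even exponents, localised by a band-limited weight and made
vector-valued through square functions.

Since `Λ_f` is symmetric, a nonzero exponent `ξ` lies in it together with `-ξ`, so separation forces
`|ξ| > α/2`. The sign function therefore jumps inside a spectral gap: for `δ = α/4` there is `a`
such that the relevant frequencies with sign `1` are at least `a` and those with sign `-1` are at
most `a - δ`.

Let `f_j` be trigonometric polynomials with this gap, `g_j = H f_j`, `Φ = ∑ |f_j|²`, `G = ∑ |g_j|²`.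
The frequencies of `f_j + i g_j` are at least `a`, those of the conjugate of `f_j - i g_j` at least
`δ - a`. Hence `z = ∑ (f_j + i g_j) conj(f_j - i g_j)` and all its positive powers have frequencies
at least `δ`, and they integrate to zero against translates of a weight `v ≥ 0` whose Fourier
transform lives in `(-δ, δ)`. Moreover `Re z = Φ - G` and `(Im z)² ≤ 4ΦG`, whence pointwise `G^(m+1)
≤ C Φ^(m+1) + 2 Re (-z)^(m+1)` (`exists_pow_le_add_re`). Integration against `v` removes the last
term (`integral_weight_hilbert_le`), and averaging over translates of `v` gives the Stepanov bound
with exponent `2(m+1)` and a constant depending only on `m` and `δ`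
(`exists_stepNorm_hilbert_trig_le`).

To reach `S^p`, the approximating polynomials must themselves have the gap. Convolution with a
low-pass kernel turns `f` into its mean value, by uniqueness of Fourier coefficients, so the low
frequencies of the approximants can be removed (`Approx.exists_gap`). Uniqueness is an `S²` fact:
almost periodicity bounds the quadratic mean of a nonzero `f` from below, while vanishing
coefficients make `f` orthogonal in mean to its own approximants (`Approx.ae_eq_zero_two`).
Existence of `H f` follows from the scalar bound and completeness; infinite sequences follow by
monotone convergence. -/

namespace Stepanov

/-! ### The Stepanov norm: triangle inequality, translations, completeness -/

section StepNorm

variable {E : Type*} {p : ℝ}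

lemma stepNorm_eq_iSup_eLpNorm [TopologicalSpace E] [ContinuousENorm E] (hp : 0 < p) (f : ℝ → E) :
    stepNorm p f =
      ⨆ x : ℝ, eLpNorm f (ENNReal.ofReal p) (volume.restrict (Set.Icc x (x + 1))) := by
  unfold stepNorm
  have h := (ENNReal.orderIsoRpow (1 / p) (by positivity)).map_iSup
    (fun x : ℝ => ∫⁻ s in Set.Icc x (x + 1), ‖f s‖ₑ ^ p)
  simp only [ENNReal.orderIsoRpow_apply] at h
  rw [h]
  congr 1 with x
  rw [eLpNorm_eq_lintegral_rpow_enorm_toReal (by simpa using hp) ENNReal.ofReal_ne_top,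
    ENNReal.toReal_ofReal hp.le]

lemma eLpNorm_le_stepNorm [TopologicalSpace E] [ContinuousENorm E] (hp : 0 < p) (f : ℝ → E)
    (x : ℝ) :
    eLpNorm f (ENNReal.ofReal p) (volume.restrict (Set.Icc x (x + 1))) ≤ stepNorm p f := by
  rw [stepNorm_eq_iSup_eLpNorm hp]
  exact le_iSup (fun x : ℝ => eLpNorm f (ENNReal.ofReal p) (volume.restrict (Set.Icc x (x + 1)))) x

lemma lintegral_le_stepNorm_rpow [ENorm E] (hp : 0 < p) (f : ℝ → E) (x : ℝ) :
    ∫⁻ s in Set.Icc x (x + 1), ‖f s‖ₑ ^ p ≤ stepNorm p f ^ p := by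
  unfold stepNorm
  rw [← ENNReal.rpow_mul, one_div_mul_cancel hp.ne', ENNReal.rpow_one]
  exact le_iSup (fun x : ℝ => ∫⁻ s in Set.Icc x (x + 1), ‖f s‖ₑ ^ p) x

lemma stepNorm_le_of_lintegral_le [ENorm E] (hp : 0 < p) {f : ℝ → E} {B : ℝ≥0∞}
    (h : ∀ x : ℝ, ∫⁻ s in Set.Icc x (x + 1), ‖f s‖ₑ ^ p ≤ B ^ p) : stepNorm p f ≤ B := by
  unfold stepNorm
  calc _ ≤ (B ^ p) ^ (1 / p) := by gcongr; exact iSup_le h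
    _ = B := by rw [← ENNReal.rpow_mul, mul_one_div_cancel hp.ne', ENNReal.rpow_one]

lemma stepNorm_mono {F : Type*} [ENorm E] [ENorm F] (hp : 0 < p) {f : ℝ → E} {g : ℝ → F}
    (h : ∀ᵐ x, ‖f x‖ₑ ≤ ‖g x‖ₑ) : stepNorm p f ≤ stepNorm p g := by
  refine stepNorm_le_of_lintegral_le hp fun x => ?_
  refine le_trans (lintegral_mono_ae ?_) (lintegral_le_stepNorm_rpow hp g x)
  filter_upwards [ae_restrict_of_ae h] with s hs
  gcongr

lemma stepNorm_congr {F : Type*} [ENorm E] [ENorm F] (hp : 0 < p) {f : ℝ → E} {g : ℝ → F}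
    (h : ∀ᵐ x, ‖f x‖ₑ = ‖g x‖ₑ) : stepNorm p f = stepNorm p g :=
  le_antisymm (stepNorm_mono hp (h.mono fun _ h => h.le)) (stepNorm_mono hp (h.mono fun _ h => h.ge))

lemma stepNorm_congr_ae [ENorm E] (hp : 0 < p) {f g : ℝ → E} (h : f =ᵐ[volume] g) :
    stepNorm p f = stepNorm p g :=
  stepNorm_congr hp (h.mono fun x hx => by rw [hx])

lemma stepNorm_add_le [TopologicalSpace E] [ESeminormedAddMonoid E] [ContinuousAdd E]
    (hp : 1 ≤ p) {f g : ℝ → E}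
    (hf : AEStronglyMeasurable f volume) (hg : AEStronglyMeasurable g volume) :
    stepNorm p (f + g) ≤ stepNorm p f + stepNorm p g := by
  have hp0 : 0 < p := by linarith
  rw [stepNorm_eq_iSup_eLpNorm hp0 (f + g)]
  refine iSup_le fun x => ?_
  refine (eLpNorm_add_le hf.restrict hg.restrict (by simpa using hp)).trans ?_
  gcongr <;> exact eLpNorm_le_stepNorm hp0 _ x

lemma stepNorm_sub_comm (hp : 0 < p) (f g : ℝ → ℂ) : stepNorm p (f - g) = stepNorm p (g - f) :=
  stepNorm_congr hp (.of_forall fun x => by simp [enorm_sub_rev])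

lemma stepNorm_sub_le (hp : 1 ≤ p) {f g h : ℝ → ℂ} (hf : AEStronglyMeasurable f volume)
    (hg : AEStronglyMeasurable g volume) (hh : AEStronglyMeasurable h volume) :
    stepNorm p (f - h) ≤ stepNorm p (f - g) + stepNorm p (g - h) := by
  rw [show f - h = (f - g) + (g - h) by abel]
  exact stepNorm_add_le hp (hf.sub hg) (hg.sub hh)

lemma lintegral_Icc_comp_add_right (F : ℝ → ℝ≥0∞) (x τ : ℝ) :
    ∫⁻ s in Set.Icc x (x + 1), F (s + τ) = ∫⁻ s in Set.Icc (x + τ) (x + τ + 1), F s := by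
  have h := (measurePreserving_add_right volume τ).setLIntegral_comp_preimage_emb
    (measurableEmbedding_addRight τ) F (Set.Icc (x + τ) (x + τ + 1))
  rw [← h]
  congr 2
  ext s
  simp only [Set.mem_Icc, Set.mem_preimage]
  constructor <;> rintro ⟨h1, h2⟩ <;> constructor <;> linarith

lemma stepNorm_comp_add_right [ENorm E] (hp : 0 < p) (f : ℝ → E) (τ : ℝ) :
    stepNorm p (fun x => f (x + τ)) ≤ stepNorm p f := by
  refine stepNorm_le_of_lintegral_le hp fun x => ?_
  rw [lintegral_Icc_comp_add_right (fun s => ‖f s‖ₑ ^ p)]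
  exact lintegral_le_stepNorm_rpow hp f _

/-- Total mass one makes the local `L^p` norms, hence the Stepanov norms, increase with the exponent
without any constant. -/
instance (x : ℝ) : IsProbabilityMeasure (volume.restrict (Set.Icc x (x + 1))) :=
  ⟨by simp⟩

lemma stepNorm_le_stepNorm_of_exponent_le {q : ℝ} (hp : 0 < p) (hpq : p ≤ q) {f : ℝ → ℂ}
    (hf : AEStronglyMeasurable f volume) : stepNorm p f ≤ stepNorm q f := by
  rw [stepNorm_eq_iSup_eLpNorm hp]
  refine iSup_le fun x => ?_
  exact (eLpNorm_le_eLpNorm_of_exponent_le (ENNReal.ofReal_le_ofReal hpq) hf.restrict).trans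
    (eLpNorm_le_stepNorm (hp.trans_le hpq) f x)

lemma stepNorm_const_le (hp : 0 < p) {f : ℝ → ℂ} {B : ℝ≥0∞} (h : ∀ x, ‖f x‖ₑ ≤ B) :
    stepNorm p f ≤ B := by
  refine stepNorm_le_of_lintegral_le hp fun x => ?_
  calc _ ≤ ∫⁻ s in Set.Icc x (x + 1), B ^ p := lintegral_mono fun s => by gcongr; exact h s
    _ = B ^ p := by simp

lemma ae_of_ae_restrict_Icc {P : ℝ → Prop}
    (h : ∀ n : ℤ, ∀ᵐ x ∂(volume.restrict (Set.Icc (n : ℝ) (n + 1))), P x) : ∀ᵐ x, P x := by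
  have h1 := (ae_restrict_iUnion_iff (μ := volume) (fun n : ℤ => Set.Icc (n : ℝ) (n + 1)) P).2 h
  have h2 : ⋃ n : ℤ, Set.Icc (n : ℝ) (n + 1) = Set.univ := by
    refine Set.eq_univ_of_forall fun x => Set.mem_iUnion.2 ⟨⌊x⌋, Int.floor_le x, ?_⟩
    exact (Int.lt_floor_add_one x).le
  rwa [h2, Measure.restrict_univ] at h1

lemma ae_eq_zero_of_stepNorm_eq_zero (hp : 0 < p) {f : ℝ → ℂ} (hf : AEStronglyMeasurable f volume)
    (h : stepNorm p f = 0) : f =ᵐ[volume] 0 := by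
  refine ae_of_ae_restrict_Icc fun n => ?_
  have h1 := eLpNorm_le_stepNorm hp f n
  rw [h, nonpos_iff_eq_zero, eLpNorm_eq_zero_iff hf.restrict (by simpa using hp)] at h1
  exact h1

/-- Completeness of the Stepanov norm. -/
lemma exists_tendsto_stepNorm (hp : 1 ≤ p) {F : ℕ → ℝ → ℂ}
    (hF : ∀ n, AEStronglyMeasurable (F n) volume)
    (hcau : ∀ ε : ℝ≥0∞, 0 < ε → ∃ N, ∀ n ≥ N, ∀ m ≥ N, stepNorm p (F n - F m) < ε) :
    ∃ g : ℝ → ℂ, AEStronglyMeasurable g volume ∧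
      Tendsto (fun n => stepNorm p (F n - g)) atTop (𝓝 0) := by
  have hp0 : 0 < p := by linarith
  let B : ℕ → ℝ≥0∞ := fun n => 2⁻¹ ^ n
  have hB : ∑' i, B i ≠ ∞ := by
    simp only [B, ENNReal.tsum_geometric]
    simp
  have hB0 : ∀ n, 0 < B n := fun n => ENNReal.pow_pos (by simp) n
  choose N hN using fun n => hcau (B n) (hB0 n)
  -- The sum makes `φ n ≥ N k` for every `k ≤ n`; the summand `n` makes `φ n ≥ n`.
  let φ : ℕ → ℕ := fun n => n + ∑ i ∈ Finset.range (n + 1), N i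
  have hφ : ∀ k n, k ≤ n → N k ≤ φ n := fun k n hkn =>
    (Finset.single_le_sum (f := N) (fun _ _ => Nat.zero_le _)
      (Finset.mem_range.2 (by omega))).trans (Nat.le_add_left _ _)
  have hsub : ∀ k n m, k ≤ n → k ≤ m → stepNorm p (F (φ n) - F (φ m)) < B k := fun k n m hn hm =>
    hN k _ (hφ k n hn) _ (hφ k m hm)
  have hae : ∀ᵐ x, ∃ l, Tendsto (fun n => F (φ n) x) atTop (𝓝 l) := by
    refine ae_of_ae_restrict_Icc fun z => ?_
    refine Lp.ae_tendsto_of_cauchy_eLpNorm (p := ENNReal.ofReal p) (fun n => (hF (φ n)).restrict)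
      (by simpa using hp) hB fun k n m hn hm => ?_
    exact (eLpNorm_le_stepNorm hp0 _ _).trans_lt (hsub k n m hn hm)
  obtain ⟨g, hg, hlim⟩ := exists_stronglyMeasurable_limit_of_tendsto_ae (fun n => hF (φ n)) hae
  refine ⟨g, hg.aestronglyMeasurable, ?_⟩
  rw [ENNReal.tendsto_atTop_zero]
  intro ε hε
  obtain ⟨M, hM⟩ := hcau ε hε
  refine ⟨M, fun n hn => ?_⟩
  -- Fatou on each unit interval: the Cauchy bound does not depend on the interval, so it survives
  -- the supremum.
  rw [stepNorm_eq_iSup_eLpNorm hp0]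
  refine iSup_le fun x => ?_
  refine Lp.eLpNorm_le_of_ae_tendsto (u := atTop) (f := fun m => F n - F (φ m)) ?_
    (fun m => ((hF n).sub (hF (φ m))).restrict) ?_
  · filter_upwards [eventually_ge_atTop M] with m hm
    exact (eLpNorm_le_stepNorm hp0 _ _).trans
      (hM n hn _ (hm.trans (Nat.le_add_right _ _))).le
  · filter_upwards [ae_restrict_of_ae hlim] with s hs
    exact tendsto_const_nhds.sub hs

end StepNorm

/-! ### Trigonometric polynomials and approximating sequences -/

/-- The trigonometric polynomial `∑ c_ξ e^{iξx}` with coefficients `c`. -/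
noncomputable def trig : (ℝ →₀ ℂ) →ₗ[ℂ] (ℝ → ℂ) :=
  Finsupp.linearCombination ℂ fun (ξ x : ℝ) => Complex.exp (Complex.I * ξ * x)

lemma trig_apply (c : ℝ →₀ ℂ) (x : ℝ) :
    trig c x = ∑ ξ ∈ c.support, c ξ * Complex.exp (Complex.I * ξ * x) := by
  simp [trig, Finsupp.linearCombination_apply, Finsupp.sum]

lemma trig_single (ξ : ℝ) (a : ℂ) (x : ℝ) :
    trig (Finsupp.single ξ a) x = a * Complex.exp (Complex.I * ξ * x) := by
  simp [trig]

lemma isTrigPoly_trig (c : ℝ →₀ ℂ) : IsTrigPoly (trig c) :=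
  ⟨c.support, c, trig_apply c⟩

lemma IsTrigPoly.exists_eq_trig {P : ℝ → ℂ} (hP : IsTrigPoly P) : ∃ c, P = trig c := by
  obtain ⟨s, c, h⟩ := hP
  refine ⟨∑ ξ ∈ s, Finsupp.single ξ (c ξ), funext fun x => ?_⟩
  rw [h, map_sum, Finset.sum_apply]
  simp [trig_single]

lemma norm_exp_I_mul_mul (ξ x : ℝ) : ‖Complex.exp (Complex.I * ξ * x)‖ = 1 := by
  rw [show Complex.I * ξ * x = ((ξ * x : ℝ) : ℂ) * Complex.I by push_cast; ring,
    Complex.norm_exp_ofReal_mul_I]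

lemma norm_exp_neg_I_mul_mul (ξ x : ℝ) : ‖Complex.exp (-(Complex.I * ξ * x))‖ = 1 := by
  rw [show -(Complex.I * ξ * x) = ((-(ξ * x) : ℝ) : ℂ) * Complex.I by push_cast; ring,
    Complex.norm_exp_ofReal_mul_I]

lemma continuous_trig (c : ℝ →₀ ℂ) : Continuous (trig c) := by
  rw [show trig c = fun x : ℝ => ∑ ξ ∈ c.support, c ξ * Complex.exp (Complex.I * ξ * x) from
    funext (trig_apply c)]
  fun_prop

lemma aestronglyMeasurable_trig (c : ℝ →₀ ℂ) : AEStronglyMeasurable (trig c) volume :=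
  (continuous_trig c).aestronglyMeasurable

lemma norm_trig_le (c : ℝ →₀ ℂ) (x : ℝ) : ‖trig c x‖ ≤ ∑ ξ ∈ c.support, ‖c ξ‖ := by
  rw [trig_apply]
  refine (norm_sum_le _ _).trans (Finset.sum_le_sum fun ξ _ => ?_)
  rw [norm_mul, norm_exp_I_mul_mul, mul_one]

lemma stepNorm_trig_lt_top {p : ℝ} (hp : 0 < p) (c : ℝ →₀ ℂ) : stepNorm p (trig c) < ∞ := by
  refine (stepNorm_const_le hp (B := ENNReal.ofReal (∑ ξ ∈ c.support, ‖c ξ‖)) fun x => ?_).trans_lt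
    ENNReal.ofReal_lt_top
  rw [← ofReal_norm]
  exact ENNReal.ofReal_le_ofReal (norm_trig_le c x)

/-- The sequence of trigonometric polynomials with coefficients `c n` converges to `f` in the
Stepanov norm. -/
def Approx (p : ℝ) (f : ℝ → ℂ) (c : ℕ → ℝ →₀ ℂ) : Prop :=
  AEStronglyMeasurable f volume ∧ Tendsto (fun n => stepNorm p (f - trig (c n))) atTop (𝓝 0)

lemma Mem.exists_approx {p : ℝ} {f : ℝ → ℂ} (hf : Mem p f) : ∃ c, Approx p f c := by
  have h : ∀ n : ℕ, ∃ c, stepNorm p (f - trig c) < (n : ℝ≥0∞)⁻¹ := fun n => by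
    obtain ⟨P, hP, h⟩ := hf.2 (n : ℝ≥0∞)⁻¹ (by simp)
    obtain ⟨c, rfl⟩ := hP.exists_eq_trig
    exact ⟨c, h⟩
  choose c hc using h
  exact ⟨c, hf.1, tendsto_of_tendsto_of_tendsto_of_le_of_le tendsto_const_nhds
    ENNReal.tendsto_inv_nat_nhds_zero (fun _ => zero_le) fun n => (hc n).le⟩

lemma Approx.mem {p : ℝ} {f : ℝ → ℂ} {c : ℕ → ℝ →₀ ℂ} (h : Approx p f c) : Mem p f := by
  refine ⟨h.1, fun ε hε => ?_⟩
  obtain ⟨n, hn⟩ := (h.2.eventually (gt_mem_nhds hε)).exists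
  exact ⟨_, isTrigPoly_trig _, hn⟩

lemma Approx.sub {p : ℝ} (hp : 1 ≤ p) {f g : ℝ → ℂ} {c d : ℕ → ℝ →₀ ℂ} (hf : Approx p f c)
    (hg : Approx p g d) : Approx p (f - g) fun n => c n - d n := by
  refine ⟨hf.1.sub hg.1, ?_⟩
  refine tendsto_of_tendsto_of_tendsto_of_le_of_le tendsto_const_nhds
    (by simpa using hf.2.add hg.2) (fun _ => zero_le) fun n => ?_
  simp only
  rw [stepNorm_sub_comm (by linarith) g, map_sub,
    show f - g - (trig (c n) - trig (d n)) = (f - trig (c n)) + (trig (d n) - g) by abel]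
  exact stepNorm_add_le hp (hf.1.sub (aestronglyMeasurable_trig _))
    ((aestronglyMeasurable_trig _).sub hg.1)

lemma approx_trig {p : ℝ} (hp : 0 < p) (c : ℝ →₀ ℂ) : Approx p (trig c) fun _ => c := by
  refine ⟨aestronglyMeasurable_trig c, ?_⟩
  have : stepNorm p (trig c - trig c) = 0 := le_antisymm (stepNorm_const_le hp (by simp)) zero_le
  simp only [this]
  exact tendsto_const_nhds

lemma Approx.stepNorm_lt_top {p : ℝ} (hp : 1 ≤ p) {f : ℝ → ℂ} {c : ℕ → ℝ →₀ ℂ}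
    (h : Approx p f c) : stepNorm p f < ∞ := by
  obtain ⟨n, hn⟩ := (h.2.eventually (gt_mem_nhds one_pos)).exists
  calc stepNorm p f = stepNorm p ((f - trig (c n)) + trig (c n)) := by simp
    _ ≤ _ := stepNorm_add_le hp (h.1.sub (aestronglyMeasurable_trig _)) (aestronglyMeasurable_trig _)
    _ < ∞ := ENNReal.add_lt_top.2 ⟨hn.trans_le le_top, stepNorm_trig_lt_top (by linarith) _⟩

lemma Approx.cauchy {p : ℝ} (hp : 1 ≤ p) {f : ℝ → ℂ} {c : ℕ → ℝ →₀ ℂ} (h : Approx p f c)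
    (ε : ℝ≥0∞) (hε : 0 < ε) :
    ∃ N, ∀ n ≥ N, ∀ m ≥ N, stepNorm p (trig (c n - c m)) < ε := by
  obtain ⟨N, hN⟩ := eventually_atTop.1 (h.2.eventually (gt_mem_nhds (ENNReal.half_pos hε.ne')))
  refine ⟨N, fun n hn m hm => ?_⟩
  rw [map_sub]
  refine (stepNorm_sub_le hp (aestronglyMeasurable_trig _) h.1 (aestronglyMeasurable_trig _)).trans_lt ?_
  rw [stepNorm_sub_comm (by linarith) _ f, ← ENNReal.add_halves ε]
  exact ENNReal.add_lt_add (hN n hn) (hN m hm)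

lemma exists_approx_of_cauchy {p : ℝ} (hp : 1 ≤ p) {c : ℕ → ℝ →₀ ℂ}
    (hcau : ∀ ε : ℝ≥0∞, 0 < ε → ∃ N, ∀ n ≥ N, ∀ m ≥ N, stepNorm p (trig (c n - c m)) < ε) :
    ∃ g, Approx p g c := by
  obtain ⟨g, hg, h⟩ := exists_tendsto_stepNorm hp (fun n => aestronglyMeasurable_trig (c n))
    (by simpa only [map_sub] using hcau)
  refine ⟨g, hg, h.congr fun n => stepNorm_sub_comm (by linarith) _ _⟩

/-! ### Fourier coefficients as limits of truncated means -/

/-- The truncated mean whose limit is the Fourier coefficient. -/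
noncomputable def truncMean (f : ℝ → ℂ) (ξ T : ℝ) : ℂ :=
  (1 / (2 * T) : ℂ) * ∫ x in (-T)..T, f x * Complex.exp (-(Complex.I * ξ * x))

lemma lintegral_Icc_le_nat_mul {F : ℝ → ℝ≥0∞} {B : ℝ≥0∞}
    (h : ∀ x, ∫⁻ s in Set.Icc x (x + 1), F s ≤ B) (a : ℝ) (n : ℕ) :
    ∫⁻ s in Set.Icc a (a + n), F s ≤ n * B := by
  induction n with
  | zero => simp
  | succ n ih =>
    have hsub : Set.Icc a (a + (n + 1 : ℕ)) ⊆
        Set.Icc a (a + n) ∪ Set.Icc (a + n) (a + n + 1) := by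
      rintro s ⟨h1, h2⟩
      push_cast at h2
      rcases le_total s (a + n) with h3 | h3
      · exact Or.inl ⟨h1, h3⟩
      · exact Or.inr ⟨h3, by linarith⟩
    calc _ ≤ _ := lintegral_mono_set hsub
      _ ≤ _ := lintegral_union_le _ _ _
      _ ≤ n * B + B := by gcongr; exact h _
      _ = _ := by push_cast; ring

lemma lintegral_Icc_le_stepNorm {p : ℝ} (hp : 1 ≤ p) {f : ℝ → ℂ}
    (hf : AEStronglyMeasurable f volume) (a : ℝ) (n : ℕ) :
    ∫⁻ s in Set.Icc a (a + n), ‖f s‖ₑ ≤ n * stepNorm p f := by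
  refine lintegral_Icc_le_nat_mul (fun x => ?_) a n
  have h := (lintegral_le_stepNorm_rpow one_pos f x)
  simp only [ENNReal.rpow_one] at h
  exact h.trans (stepNorm_le_stepNorm_of_exponent_le one_pos hp hf)

lemma integrableOn_of_stepNorm_lt_top {p : ℝ} (hp : 1 ≤ p) {f : ℝ → ℂ}
    (hf : AEStronglyMeasurable f volume) (h : stepNorm p f < ∞) (a b : ℝ) :
    IntegrableOn f (Set.Icc a b) := by
  refine ⟨hf.restrict, ?_⟩
  obtain ⟨n, hn⟩ := exists_nat_ge (b - a)
  refine ((lintegral_mono_set (Set.Icc_subset_Icc_right (by linarith))).trans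
    (lintegral_Icc_le_stepNorm hp hf a n)).trans_lt ?_
  exact ENNReal.mul_lt_top (by simp) h

lemma intervalIntegrable_mul_exp {p : ℝ} (hp : 1 ≤ p) {f : ℝ → ℂ}
    (hf : AEStronglyMeasurable f volume) (h : stepNorm p f < ∞) (ξ a b : ℝ) :
    IntervalIntegrable (fun x : ℝ => f x * Complex.exp (-(Complex.I * ξ * x))) volume a b := by
  have h1 : IntervalIntegrable f volume a b := by
    rw [intervalIntegrable_iff']
    exact integrableOn_of_stepNorm_lt_top hp hf h _ _
  exact h1.mul_continuousOn (by fun_prop)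

lemma truncMean_sub {p : ℝ} (hp : 1 ≤ p) {f g : ℝ → ℂ} (hf : AEStronglyMeasurable f volume)
    (hf' : stepNorm p f < ∞) (hg : AEStronglyMeasurable g volume) (hg' : stepNorm p g < ∞)
    (ξ T : ℝ) : truncMean (f - g) ξ T = truncMean f ξ T - truncMean g ξ T := by
  unfold truncMean
  rw [← mul_sub, ← intervalIntegral.integral_sub (intervalIntegrable_mul_exp hp hf hf' _ _ _)
    (intervalIntegrable_mul_exp hp hg hg' _ _ _)]
  simp [sub_mul]

/-- The window `[-T, T]` is covered by `⌈2T⌉` unit intervals, and `⌈2T⌉ / (2T) ≤ 2` for `T ≥ 1`.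
Uniformity in `T` is what later permits the exchange of limits. -/
lemma enorm_truncMean_le {p : ℝ} (hp : 1 ≤ p) {f : ℝ → ℂ} (hf : AEStronglyMeasurable f volume)
    (ξ : ℝ) {T : ℝ} (hT : 1 ≤ T) : ‖truncMean f ξ T‖ₑ ≤ 2 * stepNorm p f := by
  have hT0 : 0 < T := by linarith
  have hn := Nat.le_ceil (2 * T)
  have hn' := Nat.ceil_lt_add_one (a := 2 * T) (by positivity)
  set n := ⌈2 * T⌉₊
  have h1 : ‖∫ x in (-T)..T, f x * Complex.exp (-(Complex.I * ξ * x))‖ₑ ≤ n * stepNorm p f := by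
    rw [intervalIntegral.integral_of_le (by linarith)]
    refine (enorm_integral_le_lintegral_enorm _).trans ?_
    refine le_trans ?_ (lintegral_Icc_le_stepNorm hp hf (-T) n)
    refine le_trans (le_of_eq ?_) (lintegral_mono_set (s := Set.Ioc (-T) T) ?_)
    · refine lintegral_congr fun x => ?_
      rw [enorm_mul, ← ofReal_norm (Complex.exp _), norm_exp_neg_I_mul_mul]
      simp
    · exact fun s hs => ⟨hs.1.le, by linarith [hs.2]⟩
  unfold truncMean
  rw [enorm_mul]
  have h2 : ‖(1 / (2 * T) : ℂ)‖ₑ = ENNReal.ofReal (1 / (2 * T)) := by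
    rw [← ofReal_norm]
    congr 1
    rw [show (1 / (2 * T) : ℂ) = ((1 / (2 * T) : ℝ) : ℂ) by push_cast; ring, Complex.norm_real,
      Real.norm_of_nonneg (by positivity)]
  rw [h2]
  calc _ ≤ ENNReal.ofReal (1 / (2 * T)) * (n * stepNorm p f) := by gcongr
    _ = ENNReal.ofReal (1 / (2 * T) * n) * stepNorm p f := by
      rw [ENNReal.ofReal_mul (by positivity), ENNReal.ofReal_natCast, mul_assoc]
    _ ≤ ENNReal.ofReal 2 * stepNorm p f := by
      gcongr
      rw [div_mul_eq_mul_div, div_le_iff₀ (by positivity)]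
      linarith
    _ = _ := by simp

lemma tendsto_truncMean_single (η : ℝ) (a : ℂ) (ξ : ℝ) :
    Tendsto (truncMean (trig (Finsupp.single η a)) ξ) atTop (𝓝 (Finsupp.single η a ξ)) := by
  by_cases h : η = ξ
  · subst h
    refine tendsto_const_nhds.congr' ?_
    filter_upwards [eventually_gt_atTop 0] with T hT
    have hT' : (T : ℂ) ≠ 0 := by exact_mod_cast hT.ne'
    simp only [truncMean, trig_single, mul_assoc, ← Complex.exp_add]
    simp
    field_simp
    ring
  · rw [Finsupp.single_eq_of_ne (Ne.symm h)]
    set b : ℂ := Complex.I * ((η - ξ : ℝ) : ℂ) with hb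
    have hb0 : b ≠ 0 := mul_ne_zero Complex.I_ne_zero (by exact_mod_cast sub_ne_zero.2 h)
    have hint : ∀ T : ℝ, ∫ x in (-T)..T, trig (Finsupp.single η a) x *
        Complex.exp (-(Complex.I * ξ * x)) =
        a * ((Complex.exp (b * T) - Complex.exp (b * (-T : ℝ))) / b) := fun T => by
      rw [← integral_exp_mul_complex hb0, ← intervalIntegral.integral_const_mul]
      congr 1
      ext x
      rw [trig_single, mul_assoc, ← Complex.exp_add]
      congr 2
      rw [hb]; push_cast; ring
    refine squeeze_zero_norm' (a := fun T : ℝ => (1 / (2 * T)) * (‖a‖ * (2 / ‖b‖))) ?_ ?_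
    · filter_upwards [eventually_gt_atTop 0] with T hT
      unfold truncMean
      rw [hint, norm_mul, norm_mul a, norm_div _ b]
      have h1 : ‖(1 / (2 * T) : ℂ)‖ = 1 / (2 * T) := by
        rw [show (1 / (2 * T) : ℂ) = ((1 / (2 * T) : ℝ) : ℂ) by push_cast; ring, Complex.norm_real,
          Real.norm_of_nonneg (by positivity)]
      rw [h1]
      gcongr
      refine (norm_sub_le _ _).trans ?_
      rw [hb, norm_exp_I_mul_mul, norm_exp_I_mul_mul]
      norm_num
    · have : Tendsto (fun T : ℝ => 1 / (2 * T)) atTop (𝓝 0) := by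
        simp only [one_div]
        exact tendsto_inv_atTop_zero.comp (tendsto_id.const_mul_atTop two_pos)
      simpa using this.mul_const (‖a‖ * (2 / ‖b‖))

lemma tendsto_truncMean_trig (c : ℝ →₀ ℂ) (ξ : ℝ) :
    Tendsto (truncMean (trig c) ξ) atTop (𝓝 (c ξ)) := by
  induction c using Finsupp.induction_linear with
  | zero =>
    have : truncMean (trig 0) ξ = fun _ => 0 := by ext T; simp [truncMean]
    rw [this]; exact tendsto_const_nhds
  | single η a => exact tendsto_truncMean_single η a ξ
  | add c d hc hd =>
    refine (hc.add hd).congr fun T => ?_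
    rw [eq_comm, ← sub_eq_iff_eq_add, ← truncMean_sub le_rfl (aestronglyMeasurable_trig _)
      (stepNorm_trig_lt_top one_pos _) (aestronglyMeasurable_trig _)
      (stepNorm_trig_lt_top one_pos _), ← map_sub]
    simp

lemma enorm_apply_le_stepNorm_trig {p : ℝ} (hp : 1 ≤ p) (c : ℝ →₀ ℂ) (ξ : ℝ) :
    ‖c ξ‖ₑ ≤ 2 * stepNorm p (trig c) := by
  refine le_of_tendsto (tendsto_truncMean_trig c ξ).enorm ?_
  filter_upwards [eventually_ge_atTop 1] with T hT
  exact enorm_truncMean_le hp (aestronglyMeasurable_trig c) ξ hT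

/-- The truncated means of the approximants converge uniformly in `T ≥ 1`, so the limits in `n` and
in `T` may be exchanged. This identifies the Fourier coefficient of `f` with the limit of the
polynomial coefficients. -/
lemma Approx.exists_tendsto {p : ℝ} (hp : 1 ≤ p) {f : ℝ → ℂ} {c : ℕ → ℝ →₀ ℂ}
    (h : Approx p f c) (ξ : ℝ) :
    ∃ a, Tendsto (fun n => c n ξ) atTop (𝓝 a) ∧ Tendsto (truncMean f ξ) atTop (𝓝 a) := by
  have hcau : CauchySeq fun n => c n ξ := by
    refine EMetric.cauchySeq_iff.2 fun ε hε => ?_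
    obtain ⟨N, hN⟩ := h.cauchy hp (ε / 2) (ENNReal.half_pos hε.ne')
    refine ⟨N, fun n hn m hm => ?_⟩
    rw [edist_eq_enorm_sub, ← Finsupp.sub_apply]
    refine (enorm_apply_le_stepNorm_trig hp _ ξ).trans_lt ?_
    rw [mul_comm, ← ENNReal.lt_div_iff_mul_lt (by simp) (by simp)]
    exact hN n hn m hm
  obtain ⟨a, ha⟩ := cauchySeq_tendsto_of_complete hcau
  refine ⟨a, ha, ?_⟩
  have hunif : TendstoUniformlyOn (fun n T => truncMean (trig (c n)) ξ T) (truncMean f ξ) atTop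
      (Set.Ici 1) := by
    refine EMetric.tendstoUniformlyOn_iff.2 fun ε hε => ?_
    filter_upwards [h.2.eventually (gt_mem_nhds (ENNReal.half_pos hε.ne'))] with n hn T hT
    rw [edist_eq_enorm_sub, ← truncMean_sub hp h.1 (h.stepNorm_lt_top hp)
      (aestronglyMeasurable_trig _) (stepNorm_trig_lt_top (by linarith) _)]
    refine (enorm_truncMean_le hp (h.1.sub (aestronglyMeasurable_trig _)) ξ hT).trans_lt ?_
    rw [mul_comm, ← ENNReal.lt_div_iff_mul_lt (by simp) (by simp)]
    exact hn
  have hev : TendstoUniformlyOnFilter (fun n T => truncMean (trig (c n)) ξ T) (truncMean f ξ) atTop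
      atTop :=
    (tendstoUniformlyOn_iff_tendstoUniformlyOnFilter.1 hunif).mono_right
      (le_principal_iff.2 (Ici_mem_atTop 1))
  exact hev.tendsto_of_eventually_tendsto (.of_forall fun n => tendsto_truncMean_trig (c n) ξ) ha

lemma Approx.tendsto_truncMean {p : ℝ} (hp : 1 ≤ p) {f : ℝ → ℂ} {c : ℕ → ℝ →₀ ℂ}
    (h : Approx p f c) (ξ : ℝ) : Tendsto (truncMean f ξ) atTop (𝓝 (fourierCoeff f ξ)) := by
  obtain ⟨a, -, h2⟩ := h.exists_tendsto hp ξ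
  rwa [show fourierCoeff f ξ = a from h2.limUnder_eq]

lemma Approx.tendsto_apply {p : ℝ} (hp : 1 ≤ p) {f : ℝ → ℂ} {c : ℕ → ℝ →₀ ℂ}
    (h : Approx p f c) (ξ : ℝ) : Tendsto (fun n => c n ξ) atTop (𝓝 (fourierCoeff f ξ)) := by
  obtain ⟨a, h1, h2⟩ := h.exists_tendsto hp ξ
  rwa [show fourierCoeff f ξ = a from h2.limUnder_eq]

/-! ### Almost periodicity and uniqueness of Fourier coefficients -/

/-- Almost periods of a trigonometric polynomial are relatively dense. -/
lemma exists_almost_period_trig (c : ℝ →₀ ℂ) {ε : ℝ} (hε : 0 < ε) :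
    ∃ L : ℝ, ∀ a : ℝ, ∃ τ ∈ Set.Icc a (a + L), ∀ x, ‖trig c (x + τ) - trig c x‖ ≤ ε := by
  let φ : ℝ → c.support → ℂ := fun t ξ => Complex.exp (Complex.I * (ξ : ℝ) * t)
  have hb : TotallyBounded (Set.range φ) := by
    refine (isCompact_closedBall (0 : c.support → ℂ) 1).totallyBounded.subset ?_
    rintro _ ⟨t, rfl⟩
    rw [mem_closedBall_zero_iff, pi_norm_le_iff_of_nonneg zero_le_one]
    exact fun ξ => (norm_exp_I_mul_mul _ _).le
  set S := ∑ ξ ∈ c.support, ‖c ξ‖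
  have hS : 0 ≤ S := Finset.sum_nonneg fun _ _ => norm_nonneg _
  -- The curve `φ` stays in a compact polydisc, so finitely many of its points, with parameters `u`
  -- in some `[-R, R]`, form a net. If `φ (a + R)` is near `φ u`, then `a + R - u` is an almost
  -- period in `[a, a + 2R]`.
  obtain ⟨t, hts, htf, hcov⟩ := Metric.finite_approx_of_totallyBounded hb (ε / (S + 1))
    (by positivity)
  obtain ⟨F, -, hF, rfl⟩ := Set.exists_subset_image_finite_and.1
    ⟨t, by rwa [Set.image_univ], htf, rfl⟩
  obtain ⟨R, hR⟩ := hF.isBounded.exists_norm_le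
  refine ⟨2 * R, fun a => ?_⟩
  have h1 := hcov (Set.mem_range_self (a + R))
  simp only [Set.mem_iUnion, Set.mem_image] at h1
  obtain ⟨_, ⟨u, hu, rfl⟩, hd⟩ := h1
  have hu' := abs_le.1 (hR u hu)
  refine ⟨a + R - u, ⟨by linarith, by linarith⟩, fun x => ?_⟩
  have hξ : ∀ ξ ∈ c.support,
      ‖Complex.exp (Complex.I * ξ * (x + (a + R - u) : ℝ)) - Complex.exp (Complex.I * ξ * x)‖ ≤
        ε / (S + 1) := fun ξ hξ => by
    have h2 : ‖φ (a + R) ⟨ξ, hξ⟩ - φ u ⟨ξ, hξ⟩‖ < ε / (S + 1) := by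
      rw [← dist_eq_norm]
      exact (dist_le_pi_dist _ _ _).trans_lt hd
    have h3 : Complex.exp (Complex.I * ξ * (x + (a + R - u) : ℝ)) - Complex.exp (Complex.I * ξ * x) =
        Complex.exp (Complex.I * ξ * (x - u : ℝ)) * (φ (a + R) ⟨ξ, hξ⟩ - φ u ⟨ξ, hξ⟩) := by
      simp only [φ, mul_sub, ← Complex.exp_add]
      congr 2 <;> push_cast <;> ring
    rw [h3, norm_mul, norm_exp_I_mul_mul, one_mul]
    exact h2.le
  rw [trig_apply, trig_apply, ← Finset.sum_sub_distrib]
  calc _ ≤ ∑ ξ ∈ c.support, ‖c ξ‖ * (ε / (S + 1)) := by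
        refine (norm_sum_le _ _).trans (Finset.sum_le_sum fun ξ h => ?_)
        rw [← mul_sub, norm_mul]
        gcongr
        exact hξ ξ h
    _ = S * (ε / (S + 1)) := by rw [Finset.sum_mul]
    _ ≤ ε := by
      rw [mul_div_assoc', div_le_iff₀ (by positivity)]
      nlinarith

/-- Translates by almost periods are close to `f` in the Stepanov norm. -/
lemma Approx.exists_almost_period {p : ℝ} (hp : 1 ≤ p) {f : ℝ → ℂ} {c : ℕ → ℝ →₀ ℂ}
    (h : Approx p f c) {ε : ℝ≥0∞} (hε : 0 < ε) (hε' : ε ≠ ∞) :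
    ∃ L : ℝ, ∀ a : ℝ, ∃ τ ∈ Set.Icc a (a + L), stepNorm p ((fun x => f (x + τ)) - f) ≤ 3 * ε := by
  have hp0 : 0 < p := by linarith
  obtain ⟨n, hn⟩ := (h.2.eventually (gt_mem_nhds hε)).exists
  obtain ⟨L, hL⟩ := exists_almost_period_trig (c n) (ENNReal.toReal_pos hε.ne' hε')
  refine ⟨L, fun a => ?_⟩
  obtain ⟨τ, hτ, hx⟩ := hL a
  refine ⟨τ, hτ, ?_⟩
  have hmeas : AEStronglyMeasurable (fun x => f (x + τ)) volume :=
    h.1.comp_measurePreserving (measurePreserving_add_right volume τ)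
  have hP := continuous_trig (c n)
  have hPτ : Continuous fun x => trig (c n) (x + τ) := by fun_prop
  calc stepNorm p ((fun x => f (x + τ)) - f)
      ≤ stepNorm p ((fun x => f (x + τ)) - fun x => trig (c n) (x + τ)) +
        stepNorm p ((fun x => trig (c n) (x + τ)) - f) :=
        stepNorm_sub_le hp hmeas hPτ.aestronglyMeasurable h.1
    _ ≤ stepNorm p ((fun x => f (x + τ)) - fun x => trig (c n) (x + τ)) +
        (stepNorm p ((fun x => trig (c n) (x + τ)) - trig (c n)) + stepNorm p (trig (c n) - f)) := by
        gcongr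
        exact stepNorm_sub_le hp hPτ.aestronglyMeasurable hP.aestronglyMeasurable h.1
    _ ≤ ε + (ε + ε) := by
        gcongr
        · exact (stepNorm_comp_add_right hp0 (f - trig (c n)) τ).trans hn.le
        · refine stepNorm_const_le hp0 fun x => ?_
          rw [← ofReal_norm]
          exact ENNReal.ofReal_le_of_le_toReal (hx x)
        · rw [stepNorm_sub_comm hp0]
          exact hn.le
    _ = 3 * ε := by ring

lemma nat_mul_le_lintegral_Ioc {F : ℝ → ℝ≥0∞} {B : ℝ≥0∞} {L : ℝ} (hL : 0 ≤ L)
    (h : ∀ a, B ≤ ∫⁻ s in Set.Ioc a (a + L), F s) (a : ℝ) (n : ℕ) :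
    n * B ≤ ∫⁻ s in Set.Ioc a (a + n * L), F s := by
  induction n with
  | zero => simp
  | succ n ih =>
    have hu : Set.Ioc a (a + (n + 1 : ℕ) * L) =
        Set.Ioc a (a + n * L) ∪ Set.Ioc (a + n * L) (a + n * L + L) := by
      rw [Set.Ioc_union_Ioc_eq_Ioc (by nlinarith [n.cast_nonneg (α := ℝ)]) (by linarith)]
      push_cast; ring_nf
    rw [hu, lintegral_union measurableSet_Ioc (Set.Ioc_disjoint_Ioc_of_le le_rfl)]
    push_cast
    rw [add_mul, one_mul]
    gcongr
    exact h _

/-- If `f` is not a.e. zero then its `p`-th power has lower mean bounded below. -/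
lemma Approx.exists_lower_bound {p : ℝ} (hp : 1 ≤ p) {f : ℝ → ℂ} {c : ℕ → ℝ →₀ ℂ}
    (h : Approx p f c) (hf : stepNorm p f ≠ 0) :
    ∃ B : ℝ≥0∞, B ≠ 0 ∧ B ≠ ∞ ∧ ∃ L : ℝ, 0 < L ∧
      ∀ a, B ≤ ∫⁻ s in Set.Ioc a (a + L), ‖f s‖ₑ ^ p := by
  have hp0 : 0 < p := by linarith
  obtain ⟨x, hx⟩ : ∃ x, eLpNorm f (ENNReal.ofReal p) (volume.restrict (Set.Icc x (x + 1))) ≠ 0 := by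
    by_contra! hc
    rw [stepNorm_eq_iSup_eLpNorm hp0] at hf
    simp [hc] at hf
  set d := eLpNorm f (ENNReal.ofReal p) (volume.restrict (Set.Icc x (x + 1)))
  have hd : d ≠ ∞ := ((eLpNorm_le_stepNorm hp0 f x).trans_lt (h.stepNorm_lt_top hp)).ne
  -- Translation then costs at most `3 · d/6 = d/2`, so at least half of the local norm `d`
  -- reappears on the translated interval.
  obtain ⟨L, hL⟩ := h.exists_almost_period hp (ε := d / 6)
    (ENNReal.div_pos hx (by simp)) (ENNReal.div_ne_top hd (by simp))
  refine ⟨(d / 2) ^ p, ?_, ?_, |L| + 1, by positivity, fun a => ?_⟩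
  · simp [hx, hp0.le, ENNReal.rpow_eq_zero_iff]
  · exact ENNReal.rpow_ne_top_of_nonneg hp0.le (ENNReal.div_ne_top hd (by simp))
  obtain ⟨τ, hτ, hs⟩ := hL (a - x)
  have hmeas : AEStronglyMeasurable (fun x => f (x + τ)) volume :=
    h.1.comp_measurePreserving (measurePreserving_add_right volume τ)
  have h1 : d ≤ eLpNorm (fun x => f (x + τ)) (ENNReal.ofReal p)
      (volume.restrict (Set.Icc x (x + 1))) + d / 2 := by
    calc d = eLpNorm ((fun x => f (x + τ)) - ((fun x => f (x + τ)) - f)) (ENNReal.ofReal p)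
          (volume.restrict (Set.Icc x (x + 1))) := by simp [d]
      _ ≤ _ := eLpNorm_sub_le hmeas.restrict (hmeas.sub h.1).restrict (by simpa using hp)
      _ ≤ _ := by
        gcongr
        refine (eLpNorm_le_stepNorm hp0 _ x).trans (hs.trans (le_of_eq ?_))
        rw [div_eq_mul_inv, div_eq_mul_inv, show (6 : ℝ≥0∞) = 3 * 2 by norm_num,
          ENNReal.mul_inv (by simp) (by simp), mul_left_comm d, ← mul_assoc,
          ENNReal.mul_inv_cancel (by simp) (by simp), one_mul]
  have h2 : d / 2 ≤ eLpNorm (fun x => f (x + τ)) (ENNReal.ofReal p)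
      (volume.restrict (Set.Icc x (x + 1))) := by
    have h3 : d / 2 + d / 2 ≤ eLpNorm (fun x => f (x + τ)) (ENNReal.ofReal p)
      (volume.restrict (Set.Icc x (x + 1))) + d / 2 := by rwa [ENNReal.add_halves]
    exact (ENNReal.add_le_add_iff_right (ENNReal.div_ne_top hd (by simp))).1 h3
  rw [eLpNorm_eq_lintegral_rpow_enorm_toReal (by simpa using hp0) ENNReal.ofReal_ne_top,
    ENNReal.toReal_ofReal hp0.le, lintegral_Icc_comp_add_right (fun s => ‖f s‖ₑ ^ p)] at h2
  calc (d / 2) ^ p ≤ ((∫⁻ s in Set.Icc (x + τ) (x + τ + 1), ‖f s‖ₑ ^ p) ^ (1 / p)) ^ p := by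
        gcongr
    _ = ∫⁻ s in Set.Icc (x + τ) (x + τ + 1), ‖f s‖ₑ ^ p := by
        rw [← ENNReal.rpow_mul, one_div_mul_cancel hp0.ne', ENNReal.rpow_one]
    _ ≤ ∫⁻ s in Set.Icc a (a + (|L| + 1)), ‖f s‖ₑ ^ p := by
        refine lintegral_mono_set (Set.Icc_subset_Icc ?_ ?_)
        · linarith [hτ.1]
        · linarith [hτ.2, le_abs_self L]
    _ = _ := by rw [restrict_Ioc_eq_restrict_Icc]

lemma integrableOn_norm_sq {f : ℝ → ℂ} (hf : AEStronglyMeasurable f volume)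
    (h : stepNorm 2 f < ∞) (a b : ℝ) : IntegrableOn (fun x => ‖f x‖ ^ 2) (Set.Icc a b) := by
  refine ⟨(hf.norm.pow 2).restrict, ?_⟩
  obtain ⟨n, hn⟩ := exists_nat_ge (b - a)
  refine ((lintegral_mono_set (Set.Icc_subset_Icc_right (by linarith))).trans
    (lintegral_Icc_le_nat_mul (B := stepNorm 2 f ^ (2 : ℝ)) (fun x => ?_) a n)).trans_lt
    (ENNReal.mul_lt_top (by simp) (ENNReal.rpow_lt_top_of_nonneg (by simp) h.ne))
  refine le_trans (le_of_eq (lintegral_congr fun s => ?_)) (lintegral_le_stepNorm_rpow two_pos f x)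
  simp

lemma lintegral_enorm_sq_eq {f : ℝ → ℂ} (hf : AEStronglyMeasurable f volume)
    (h : stepNorm 2 f < ∞) {a b : ℝ} (hab : a ≤ b) :
    ∫⁻ s in Set.Ioc a b, ‖f s‖ₑ ^ (2 : ℝ) = ENNReal.ofReal (∫ x in a..b, ‖f x‖ ^ 2) := by
  rw [intervalIntegral.integral_of_le hab, ofReal_integral_eq_lintegral_ofReal]
  · refine lintegral_congr fun s => ?_
    rw [ENNReal.ofReal_pow (norm_nonneg _), ofReal_norm]
    norm_cast
  · exact (integrableOn_norm_sq hf h a b).mono_set Set.Ioc_subset_Icc_self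
  · exact .of_forall fun x => by positivity

/-- The mean is a finite linear combination of truncated means of `f`. -/
lemma tendsto_mean_mul_conj_trig {f : ℝ → ℂ} (hf : AEStronglyMeasurable f volume)
    {p : ℝ} (hp : 1 ≤ p) (hfp : stepNorm p f < ∞)
    (h0 : ∀ ξ, Tendsto (truncMean f ξ) atTop (𝓝 0)) (c : ℝ →₀ ℂ) :
    Tendsto (fun T : ℝ => (1 / (2 * T) : ℂ) * ∫ x in (-T)..T, f x * (starRingEnd ℂ) (trig c x))
      atTop (𝓝 0) := by
  have h1 : ∀ T : ℝ, (1 / (2 * T) : ℂ) * ∫ x in (-T)..T, f x * (starRingEnd ℂ) (trig c x) =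
      ∑ ξ ∈ c.support, (starRingEnd ℂ) (c ξ) * truncMean f ξ T := fun T => by
    unfold truncMean
    simp_rw [mul_left_comm _ (1 / (2 * T) : ℂ), ← Finset.mul_sum,
      ← intervalIntegral.integral_const_mul]
    rw [← intervalIntegral.integral_finsetSum fun ξ _ =>
      (intervalIntegrable_mul_exp hp hf hfp ξ (-T) T).const_mul _]
    rw [intervalIntegral.integral_const_mul]
    congr 1
    refine intervalIntegral.integral_congr fun x _ => ?_
    rw [trig_apply, map_sum, Finset.mul_sum]
    refine Finset.sum_congr rfl fun ξ _ => ?_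
    rw [map_mul, ← Complex.exp_conj]
    simp only [map_mul, Complex.conj_I, Complex.conj_ofReal]
    rw [neg_mul, neg_mul]
    ring
  simp_rw [h1]
  simpa using tendsto_finsetSum c.support fun ξ _ => (h0 ξ).const_mul ((starRingEnd ℂ) (c ξ))

/-- Uniqueness of the Fourier expansion in the Stepanov space `S^2`. -/
lemma Approx.ae_eq_zero_two {f : ℝ → ℂ} {c : ℕ → ℝ →₀ ℂ} (h : Approx 2 f c)
    (h0 : ∀ ξ, fourierCoeff f ξ = 0) : f =ᵐ[volume] 0 := by
  by_contra hne
  have hft := h.stepNorm_lt_top one_le_two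
  obtain ⟨B, hB0, hBt, L, hL, hBL⟩ := h.exists_lower_bound one_le_two
    fun hz => hne (ae_eq_zero_of_stepNorm_eq_zero two_pos h.1 hz)
  have hb : 0 < B.toReal := ENNReal.toReal_pos hB0 hBt
  -- With `T = kL`, the cross term and the error term below each contribute at most `4Tη`, in total
  -- `8Tη = kB`, against the lower bound `2kB`.
  set η := B.toReal / (8 * L) with hη
  have hη0 : 0 < η := by positivity
  obtain ⟨n, hn⟩ := (h.2.eventually 
    (gt_mem_nhds (ENNReal.ofReal_pos.2 (Real.sqrt_pos.2 hη0)))).exists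
  have hP := aestronglyMeasurable_trig (c n)
  have hdt : stepNorm 2 (f - trig (c n)) < ∞ := hn.trans_le le_top
  have hmean := tendsto_mean_mul_conj_trig h.1 one_le_two hft
    (fun ξ => by simpa [h0 ξ] using h.tendsto_truncMean one_le_two ξ) (c n)
  have hev := (hmean.norm.eventually (gt_mem_nhds (by simpa using hη0 : ‖(0 : ℂ)‖ < η))).and
    (eventually_ge_atTop 1)
  obtain ⟨T0, hT0⟩ := eventually_atTop.1 hev
  obtain ⟨k, hk⟩ := exists_nat_ge (T0 / L)
  have hTk : T0 ≤ k * L := by rwa [div_le_iff₀ hL] at hk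
  obtain ⟨hm, hT1⟩ := hT0 (k * L) hTk
  set T : ℝ := k * L with hTdef
  have hTpos : 0 < T := by linarith
  have hle : -T ≤ T := by linarith
  have hlow := nat_mul_le_lintegral_Ioc hL.le hBL (-T) (2 * k)
  rw [show -T + (2 * k : ℕ) * L = T by rw [hTdef]; push_cast; ring,
    lintegral_enorm_sq_eq h.1 hft hle] at hlow
  have hi0 : 0 ≤ ∫ x in (-T)..T, ‖f x‖ ^ 2 :=
    intervalIntegral.integral_nonneg hle fun x _ => by positivity
  have hlow' : (2 * k : ℕ) * B.toReal ≤ ∫ x in (-T)..T, ‖f x‖ ^ 2 := by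
    have := ENNReal.toReal_mono ENNReal.ofReal_ne_top hlow
    rwa [ENNReal.toReal_mul, ENNReal.toReal_natCast, ENNReal.toReal_ofReal hi0] at this
  have herr : ∫ x in (-T)..T, ‖(f - trig (c n)) x‖ ^ 2 ≤ 4 * T * η := by
    have hN := Nat.le_ceil (2 * T)
    have hN' := Nat.ceil_lt_add_one (a := 2 * T) (by positivity)
    set N := ⌈2 * T⌉₊
    have h1 : ∫⁻ s in Set.Ioc (-T) T, ‖(f - trig (c n)) s‖ₑ ^ (2 : ℝ) ≤
        N * ENNReal.ofReal (√η) ^ (2 : ℝ) := by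
      refine (lintegral_mono_set fun s hs => ?_).trans
        (lintegral_Icc_le_nat_mul (fun x => ?_) (-T) N)
      · exact (⟨hs.1.le, by linarith [hs.2]⟩ : s ∈ Set.Icc (-T) (-T + N))
      · exact (lintegral_le_stepNorm_rpow two_pos _ x).trans (by gcongr)
    rw [lintegral_enorm_sq_eq (h.1.sub hP) hdt hle, ENNReal.ofReal_rpow_of_nonneg (by positivity)
      (by norm_num), ← ENNReal.ofReal_natCast, ← ENNReal.ofReal_mul (by positivity),
      ENNReal.ofReal_le_ofReal_iff (by positivity)] at h1
    norm_num at h1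
    rw [Real.sq_sqrt hη0.le] at h1
    refine h1.trans ?_
    gcongr
    linarith
  have hcross : ‖∫ x in (-T)..T, f x * (starRingEnd ℂ) (trig (c n) x)‖ ≤ 2 * T * η := by
    have h2 : ‖(1 / (2 * T) : ℂ)‖ = 1 / (2 * T) := by
      rw [show (1 / (2 * T) : ℂ) = ((1 / (2 * T) : ℝ) : ℂ) by push_cast; ring, Complex.norm_real,
        Real.norm_of_nonneg (by positivity)]
    rw [norm_mul, h2, div_mul_eq_mul_div, one_mul, div_lt_iff₀ (by positivity)] at hm
    linarith
  have hint1 : IntervalIntegrable (fun x => ‖f x‖ ^ 2) volume (-T) T := by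
    rw [intervalIntegrable_iff']; exact integrableOn_norm_sq h.1 hft _ _
  have hint2 : IntervalIntegrable (fun x => ‖(f - trig (c n)) x‖ ^ 2) volume (-T) T := by
    rw [intervalIntegrable_iff']; exact integrableOn_norm_sq (h.1.sub hP) hdt _ _
  have hint3 : IntervalIntegrable (fun x => f x * (starRingEnd ℂ) (trig (c n) x)) volume (-T) T := by
    have h1 : IntervalIntegrable f volume (-T) T := by
      rw [intervalIntegrable_iff']
      exact integrableOn_of_stepNorm_lt_top one_le_two h.1 hft _ _
    exact h1.mul_continuousOn
      (Complex.continuous_conj.comp (continuous_trig (c n))).continuousOn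
  have hint4 : IntervalIntegrable (fun x => (f x * (starRingEnd ℂ) (trig (c n) x)).re)
      volume (-T) T := ⟨hint3.1.re, hint3.2.re⟩
  -- Expand `|f - P|²` and discard `|P|² ≥ 0`.
  have hup : ∫ x in (-T)..T, ‖f x‖ ^ 2 ≤ ∫ x in (-T)..T,
      (2 * (f x * (starRingEnd ℂ) (trig (c n) x)).re + ‖(f - trig (c n)) x‖ ^ 2) := by
    refine intervalIntegral.integral_mono_on hle hint1 ((hint4.const_mul 2).add hint2) fun x _ => ?_
    simp only [Pi.sub_apply, ← Complex.normSq_eq_norm_sq, Complex.normSq_sub]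
    linarith [Complex.normSq_nonneg (trig (c n) x)]
  rw [intervalIntegral.integral_add (hint4.const_mul 2) hint2,
    intervalIntegral.integral_const_mul] at hup
  have hre : ∫ x in (-T)..T, (f x * (starRingEnd ℂ) (trig (c n) x)).re ≤ 2 * T * η := by
    have h3 := intervalIntegral.intervalIntegral_re (𝕜 := ℂ) hint3
    simp only [RCLike.re_to_complex] at h3
    rw [h3]
    exact (Complex.re_le_norm _).trans hcross
  have hfin : T * η = k * B.toReal / 8 := by
    rw [hTdef, hη]; field_simp
  have hk0 : 0 < (k : ℝ) := by
    by_contra hcon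
    have : (k : ℝ) = 0 := le_antisymm (not_lt.1 hcon) (by positivity)
    rw [hTdef, this] at hTpos
    simp at hTpos
  have : 0 < k * B.toReal := by positivity
  push_cast at hlow'
  nlinarith

lemma Approx.of_exponent_le {p q : ℝ} (hp : 0 < p) (hpq : p ≤ q) {f : ℝ → ℂ} {c : ℕ → ℝ →₀ ℂ}
    (h : Approx q f c) : Approx p f c :=
  ⟨h.1, tendsto_of_tendsto_of_tendsto_of_le_of_le tendsto_const_nhds h.2 (fun _ => zero_le)
    fun _ => stepNorm_le_stepNorm_of_exponent_le hp hpq (h.1.sub (aestronglyMeasurable_trig _))⟩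

/-- Elements of `S^p`, `p ≥ 2`, with the same Fourier coefficients agree a.e. -/
lemma Approx.ae_eq {p : ℝ} (hp : 2 ≤ p) {f g : ℝ → ℂ} {c d : ℕ → ℝ →₀ ℂ} (hf : Approx p f c)
    (hg : Approx p g d) (h : ∀ ξ, fourierCoeff f ξ = fourierCoeff g ξ) : f =ᵐ[volume] g := by
  have h1 : 1 ≤ p := by linarith
  have hs := hf.sub h1 hg
  have h0 : f - g =ᵐ[volume] 0 := by
    refine (hs.of_exponent_le two_pos hp).ae_eq_zero_two fun ξ => ?_
    refine tendsto_nhds_unique (hs.tendsto_apply h1 ξ) ?_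
    simpa [h ξ] using (hf.tendsto_apply h1 ξ).sub (hg.tendsto_apply h1 ξ)
  filter_upwards [h0] with x hx
  exact sub_eq_zero.1 hx

/-! ### Low-pass kernel and band-limited weight -/

open FourierTransform SchwartzMap ContDiff in
/-- A smooth compactly supported function is the Fourier transform of a continuous integrable
function. -/
lemma exists_integrable_fourier_eq (χ : ℝ → ℂ) (h1 : HasCompactSupport χ) (h2 : ContDiff ℝ ∞ χ) :
    ∃ k : ℝ → ℂ, Continuous k ∧ Integrable k ∧
      ∀ ξ : ℝ, ∫ t, k t * Complex.exp (-(Complex.I * ξ * t)) = χ (ξ / (2 * Real.pi)) := by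
  let χ' := h1.toSchwartzMap h2
  refine ⟨⇑(𝓕⁻ χ' : 𝓢(ℝ, ℂ)), (𝓕⁻ χ').continuous, (𝓕⁻ χ').integrable, fun ξ => ?_⟩
  have h3 : 𝓕 (𝓕⁻ χ') (ξ / (2 * Real.pi)) = χ (ξ / (2 * Real.pi)) := by
    rw [FourierTransform.fourier_fourierInv_eq]; rfl
  rw [← h3, SchwartzMap.fourier_coe, Real.fourier_real_eq_integral_exp_smul]
  refine integral_congr_ae (.of_forall fun t => ?_)
  simp only [smul_eq_mul]
  rw [mul_comm]
  congr 2
  have : (Real.pi : ℂ) ≠ 0 := by exact_mod_cast Real.pi_ne_zero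
  push_cast
  field_simp

open ContDiff in
/-- A de la Vallée-Poussin type kernel. -/
lemma exists_low_pass_kernel {δ : ℝ} (hδ : 0 < δ) :
    ∃ k : ℝ → ℂ, Continuous k ∧ Integrable k ∧
      (∀ ξ : ℝ, |ξ| ≤ δ / 2 → ∫ t, k t * Complex.exp (-(Complex.I * ξ * t)) = 1) ∧
      ∀ ξ : ℝ, δ ≤ |ξ| → ∫ t, k t * Complex.exp (-(Complex.I * ξ * t)) = 0 := by
  have hpi := Real.pi_pos
  let b : ContDiffBump (0 : ℝ) := ⟨δ / 2 / (2 * Real.pi), δ / (2 * Real.pi), by positivity, by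
    gcongr; linarith⟩
  obtain ⟨k, hk1, hk2, hk⟩ := exists_integrable_fourier_eq (fun x => (b x : ℂ))
    (b.hasCompactSupport.comp_left Complex.ofReal_zero)
    (Complex.ofRealCLM.contDiff.comp b.contDiff)
  refine ⟨k, hk1, hk2, fun ξ hξ => ?_, fun ξ hξ => ?_⟩
  · rw [hk, b.one_of_mem_closedBall, Complex.ofReal_one]
    rw [mem_closedBall_zero_iff, Real.norm_eq_abs, abs_div, abs_of_pos (by positivity : 0 < 2 * Real.pi)]
    change _ ≤ δ / 2 / (2 * Real.pi)
    gcongr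
  · rw [hk, b.zero_of_le_dist, Complex.ofReal_zero]
    rw [dist_zero_right, Real.norm_eq_abs, abs_div, abs_of_pos (by positivity : 0 < 2 * Real.pi)]
    change δ / (2 * Real.pi) ≤ _
    gcongr

/-- On the support of `b` the phase satisfies `|2πxt| ≤ π/3`, so its cosine is at least `1/2`; the
real part of the transform already gives the bound. -/
lemma half_integral_le_norm_fourier {b : ℝ → ℝ} (hb : Continuous b) (hbc : HasCompactSupport b)
    (hb0 : ∀ x, 0 ≤ b x) (hsupp : ∀ x, 1 / 6 ≤ |x| → b x = 0) {t : ℝ} (ht : |t| ≤ 1) :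
    1 / 2 * ∫ x, b x ≤ ‖∫ x : ℝ, Complex.exp (↑(-2 * Real.pi * x * t) * Complex.I) • (b x : ℂ)‖ := by
  have hbi : Integrable b := hb.integrable_of_hasCompactSupport hbc
  have hi : Integrable fun x : ℝ =>
      Complex.exp (↑(-2 * Real.pi * x * t) * Complex.I) • (b x : ℂ) := by
    refine Integrable.mono' hbi (by fun_prop) (.of_forall fun x => ?_)
    rw [norm_smul, Complex.norm_exp_ofReal_mul_I, one_mul, Complex.norm_real,
      Real.norm_of_nonneg (hb0 x)]
  refine le_trans ?_ (Complex.re_le_norm _)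
  have hre := integral_re hi
  simp only [RCLike.re_to_complex] at hre
  rw [← hre, ← integral_const_mul]
  refine integral_mono (hbi.const_mul _) hi.re fun x => ?_
  simp only [smul_eq_mul, Complex.mul_re, Complex.ofReal_re,
    Complex.ofReal_im, mul_zero, sub_zero, Complex.exp_ofReal_mul_I_re]
  by_cases hx : 1 / 6 ≤ |x|
  · simp [hsupp x hx]
  · refine mul_le_mul_of_nonneg_right ?_ (hb0 x)
    rw [← Real.cos_pi_div_three, ← Real.cos_abs (_ * t)]
    refine Real.cos_le_cos_of_nonneg_of_le_pi (abs_nonneg _) (by linarith [Real.pi_pos]) ?_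
    rw [abs_mul, abs_mul, abs_mul, abs_neg, abs_two, abs_of_pos Real.pi_pos]
    have h1 : |x| * |t| ≤ 1 / 6 * 1 :=
      mul_le_mul (not_le.1 hx).le ht (abs_nonneg _) (by norm_num)
    nlinarith [Real.pi_pos]

open FourierTransform SchwartzMap ContDiff in
/-- An integrable nonnegative weight, bounded below near the origin, whose Fourier transform is
supported in `(-δ, δ)`. -/
lemma exists_bandlimited_weight {δ : ℝ} (hδ : 0 < δ) :
    ∃ v : ℝ → ℝ, Continuous v ∧ (∀ t, 0 ≤ v t) ∧ Integrable v ∧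
      (∃ c > 0, ∀ t, |t| ≤ 1 → c ≤ v t) ∧
      ∀ ξ : ℝ, δ ≤ |ξ| → ∫ t, (v t : ℂ) * Complex.exp (Complex.I * ξ * t) = 0 := by
  have hpi := Real.pi_pos
  -- The bound `1/6` yields positivity of the weight on `[-1, 1]`; the bound `δ/(4π)` makes
  -- translates of the bump by at least `δ/(2π)` disjoint from it.
  set r := min (1 / 6) (δ / (4 * Real.pi)) with hr
  have hr0 : 0 < r := by positivity
  let b : ContDiffBump (0 : ℝ) := ⟨r / 2, r, by positivity, by linarith⟩
  let φ : ℝ → 𝓢(ℝ, ℂ) := fun a => HasCompactSupport.toSchwartzMap (f := fun x => (b (x - a) : ℂ))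
    ((b.hasCompactSupport.comp_homeomorph (Homeomorph.subRight a)).comp_left Complex.ofReal_zero)
    (Complex.ofRealCLM.contDiff.comp (b.contDiff.comp (contDiff_id.sub contDiff_const)))
  have hφ : ∀ a x, φ a x = (b (x - a) : ℂ) := fun a x => rfl
  have hF : ∀ a t : ℝ, 𝓕 (φ a) t = Complex.exp (-(2 * Real.pi * a * t) * Complex.I) * 𝓕 (φ 0) t := by
    intro a t
    simp only [SchwartzMap.fourier_coe, Real.fourier_real_eq_integral_exp_smul, hφ]
    rw [← integral_const_mul, ← integral_add_right_eq_self _ a]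
    refine integral_congr_ae (.of_forall fun x => ?_)
    simp only [smul_eq_mul, sub_zero, add_sub_cancel_right, ← mul_assoc, ← Complex.exp_add]
    congr 2
    push_cast; ring
  refine ⟨fun t => ‖𝓕 (φ 0) t‖ ^ 2, ((𝓕 (φ 0)).continuous.norm.pow 2), fun t => by positivity, ?_,
    ⟨(1 / 2 * ∫ x, b x) ^ 2, ?_, fun t ht => ?_⟩, fun ξ hξ => ?_⟩
  · exact ((𝓕 (φ 0)).memLp 2).integrable_norm_pow two_ne_zero
  · have := b.integral_pos (μ := volume)
    positivity
  · have h0 : 0 ≤ ∫ x, b x := integral_nonneg fun x => b.nonneg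
    refine pow_le_pow_left₀ (by positivity) ?_ 2
    refine (half_integral_le_norm_fourier b.continuous b.hasCompactSupport b.nonneg' (fun x hx => ?_)
      ht).trans (le_of_eq ?_)
    · refine b.zero_of_le_dist ?_
      rw [dist_zero_right, Real.norm_eq_abs]
      exact (min_le_left _ _).trans hx
    · simp only [SchwartzMap.fourier_coe, Real.fourier_real_eq_integral_exp_smul, hφ, sub_zero]
  -- By Plancherel, the integral of `|𝓕 b|²` against `e^{iξt}` is the inner product of the bump with
  -- its translate by `a`, which vanishes because the supports are disjoint.
  · set a := -ξ / (2 * Real.pi) with ha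
    have h1 := SchwartzMap.integral_inner_fourier_fourier (φ 0) (φ a)
    have h2 : ∀ x, inner ℂ (φ 0 x) (φ a x) = 0 := fun x => by
      by_cases hx : r ≤ |x|
      · have : b x = 0 := b.zero_of_le_dist (by rwa [dist_zero_right, Real.norm_eq_abs])
        simp [hφ, this]
      · have hd : 2 * r ≤ |a| := by
          rw [ha, abs_div, abs_neg, abs_of_pos (by positivity : 0 < 2 * Real.pi),
            le_div_iff₀ (by positivity)]
          calc 2 * r * (2 * Real.pi) ≤ 2 * (δ / (4 * Real.pi)) * (2 * Real.pi) := by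
                gcongr; exact min_le_right _ _
            _ = δ := by field_simp; norm_num
            _ ≤ |ξ| := hξ
        have : b (x - a) = 0 := b.zero_of_le_dist (by
          rw [dist_zero_right, Real.norm_eq_abs]
          change r ≤ _
          have := abs_sub_abs_le_abs_sub a x
          rw [abs_sub_comm]; linarith)
        simp [hφ, this]
    simp only [h2, integral_zero] at h1
    rw [← h1]
    refine integral_congr_ae (.of_forall fun t => ?_)
    simp only
    rw [hF a, RCLike.inner_apply, mul_assoc (Complex.exp _), Complex.mul_conj', mul_comm]
    push_cast
    congr 2
    rw [ha]
    have : (Real.pi : ℂ) ≠ 0 := by exact_mod_cast Real.pi_ne_zero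
    push_cast
    field_simp

/-! ### Convolution operators on trigonometric polynomials -/

/-- The symbol of convolution with `k`. -/
noncomputable def symbol (k : ℝ → ℂ) (ξ : ℝ) : ℂ := ∫ t, k t * Complex.exp (-(Complex.I * ξ * t))

lemma trig_symbol_smul {k : ℝ → ℂ} (hk : Integrable k) (c : ℝ →₀ ℂ) (x : ℝ) :
    trig (symbol k • c) x = ∫ t, k t * trig c (x - t) := by
  have hsub : (symbol k • c).support ⊆ c.support := fun ξ hξ => by
    simp only [Finsupp.mem_support_iff, Finsupp.coe_pointwise_smul, Pi.smul_apply', smul_eq_mul,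
      ne_eq, mul_eq_zero, not_or] at hξ ⊢
    exact hξ.2
  have hi : ∀ ξ : ℝ, Integrable fun t : ℝ => k t * Complex.exp (-(Complex.I * ξ * t)) := fun ξ =>
    hk.mul_bdd (c := 1) (by fun_prop) (.of_forall fun t => (norm_exp_neg_I_mul_mul ξ t).le)
  rw [trig_apply, Finset.sum_subset hsub fun ξ _ h => by rw [Finsupp.notMem_support_iff.1 h, zero_mul]]
  have h1 : ∀ t, k t * trig c (x - t) = ∑ ξ ∈ c.support,
      (c ξ * Complex.exp (Complex.I * ξ * x)) * (k t * Complex.exp (-(Complex.I * ξ * t))) := by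
    intro t
    rw [trig_apply, Finset.mul_sum]
    refine Finset.sum_congr rfl fun ξ _ => ?_
    rw [show Complex.I * ξ * ((x - t : ℝ) : ℂ) = Complex.I * ξ * x + -(Complex.I * ξ * t) by
      push_cast; ring, Complex.exp_add]
    ring
  simp_rw [h1]
  rw [integral_finsetSum _ fun ξ _ => (hi ξ).const_mul _]
  refine Finset.sum_congr rfl fun ξ _ => ?_
  rw [integral_const_mul]
  simp only [Finsupp.coe_pointwise_smul, Pi.smul_apply', smul_eq_mul, symbol]
  ring

/-- Hölder's inequality on the finite measure with density `|k|`. -/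
lemma lintegral_enorm_mul_rpow_le {p : ℝ} (hp : 1 ≤ p) {k g : ℝ → ℂ} (hk : Continuous k)
    (hg : Continuous g) :
    (∫⁻ t, ‖k t‖ₑ * ‖g t‖ₑ) ^ p ≤ (∫⁻ t, ‖k t‖ₑ) ^ (p - 1) * ∫⁻ t, ‖k t‖ₑ * ‖g t‖ₑ ^ p := by
  have hp0 : 0 < p := by linarith
  have hkm : Measurable fun t => ‖k t‖ₑ := hk.enorm.measurable
  set ν := volume.withDensity fun t => ‖k t‖ₑ
  have h := eLpNorm_le_eLpNorm_mul_rpow_measure_univ (μ := ν) (p := 1) (q := ENNReal.ofReal p)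
    (by simpa using hp) hg.aestronglyMeasurable
  rw [eLpNorm_one_eq_lintegral_enorm,
    eLpNorm_eq_lintegral_rpow_enorm_toReal (by simpa using hp0) ENNReal.ofReal_ne_top,
    ENNReal.toReal_ofReal hp0.le, lintegral_withDensity_eq_lintegral_mul _ hkm hg.enorm.measurable,
    lintegral_withDensity_eq_lintegral_mul _ hkm (hg.enorm.measurable.pow_const p),
    withDensity_apply _ MeasurableSet.univ, Measure.restrict_univ] at h
  simp only [Pi.mul_apply, ENNReal.toReal_one] at h
  calc _ ≤ _ := ENNReal.rpow_le_rpow h hp0.le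
    _ = _ := by
      rw [ENNReal.mul_rpow_of_nonneg _ _ hp0.le, ← ENNReal.rpow_mul, ← ENNReal.rpow_mul,
        one_div_mul_cancel hp0.ne', ENNReal.rpow_one, mul_comm]
      congr 2
      field_simp

/-- Convolution with an integrable kernel is bounded in the Stepanov norm. -/
lemma stepNorm_trig_symbol_smul_le {p : ℝ} (hp : 1 ≤ p) {k : ℝ → ℂ} (hk : Integrable k)
    (hkc : Continuous k) (c : ℝ →₀ ℂ) :
    stepNorm p (trig (symbol k • c)) ≤ (∫⁻ t, ‖k t‖ₑ) * stepNorm p (trig c) := by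
  have hp0 : 0 < p := by linarith
  refine stepNorm_le_of_lintegral_le hp0 fun x => ?_
  set K := ∫⁻ t, ‖k t‖ₑ with hK
  have hKt : K ≠ ∞ := hk.2.ne
  have hP := continuous_trig c
  have hKK : K ^ (p - 1) * K = K ^ p := by
    conv_lhs => rw [← ENNReal.rpow_one K, ← ENNReal.rpow_mul, one_mul]
    rw [← ENNReal.rpow_add_of_nonneg _ _ (by linarith) zero_le_one]
    simp
  have hm : Measurable fun q : ℝ × ℝ => ‖k q.2‖ₑ * ‖trig c (q.1 - q.2)‖ₑ ^ p := by
    have h1 : Continuous fun q : ℝ × ℝ => k q.2 := hkc.comp continuous_snd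
    have h2 : Continuous fun q : ℝ × ℝ => trig c (q.1 - q.2) := by fun_prop
    exact h1.enorm.measurable.mul (h2.enorm.measurable.pow_const p)
  calc ∫⁻ s in Set.Icc x (x + 1), ‖trig (symbol k • c) s‖ₑ ^ p
      ≤ ∫⁻ s in Set.Icc x (x + 1), K ^ (p - 1) * ∫⁻ t, ‖k t‖ₑ * ‖trig c (s - t)‖ₑ ^ p := by
        refine lintegral_mono fun s => ?_
        refine le_trans ?_ (lintegral_enorm_mul_rpow_le hp hkc
          (g := fun t => trig c (s - t)) (by fun_prop))
        gcongr
        rw [trig_symbol_smul hk]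
        refine (enorm_integral_le_lintegral_enorm _).trans (le_of_eq ?_)
        simp only [enorm_mul]
    -- After Tonelli, the inner integral is over a translated unit interval, hence controlled by the
    -- Stepanov norm.
    _ = K ^ (p - 1) * ∫⁻ t, ∫⁻ s in Set.Icc x (x + 1), ‖k t‖ₑ * ‖trig c (s - t)‖ₑ ^ p := by
        rw [lintegral_const_mul _ (hm.lintegral_prod_right'), lintegral_lintegral_swap hm.aemeasurable]
    _ ≤ K ^ (p - 1) * ∫⁻ t, ‖k t‖ₑ * stepNorm p (trig c) ^ p := by
        gcongr with t
        rw [lintegral_const_mul _ (by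
          have h2 : Continuous fun s => trig c (s - t) := by fun_prop
          exact h2.enorm.measurable.pow_const p)]
        gcongr
        have := lintegral_Icc_comp_add_right (fun s => ‖trig c s‖ₑ ^ p) x (-t)
        simp only [← sub_eq_add_neg] at this
        rw [this]
        exact lintegral_le_stepNorm_rpow hp0 _ _
    _ = (K * stepNorm p (trig c)) ^ p := by
        rw [lintegral_mul_const _ hkc.enorm.measurable, ← hK, ← mul_assoc, hKK,
          ENNReal.mul_rpow_of_nonneg _ _ hp0.le]

/-! ### One-sided spectra and vanishing weighted integrals -/

/-- Trigonometric polynomials with frequencies in `[a, ∞)`. -/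
noncomputable def specGE (a : ℝ) : Submodule ℂ (ℝ → ℂ) :=
  Submodule.span ℂ ((fun (ξ x : ℝ) => Complex.exp (Complex.I * ξ * x)) '' Set.Ici a)

lemma mem_specGE_iff {a : ℝ} {h : ℝ → ℂ} :
    h ∈ specGE a ↔ ∃ c : ℝ →₀ ℂ, (∀ ξ ∈ c.support, a ≤ ξ) ∧ trig c = h := by
  unfold specGE trig
  rw [Finsupp.mem_span_image_iff_linearCombination]
  rfl

lemma trig_mem_specGE {a : ℝ} {c : ℝ →₀ ℂ} (h : ∀ ξ ∈ c.support, a ≤ ξ) : trig c ∈ specGE a :=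
  mem_specGE_iff.2 ⟨c, h, rfl⟩

lemma specGE_anti {a b : ℝ} (h : a ≤ b) : specGE b ≤ specGE a :=
  Submodule.span_mono (Set.image_mono (Set.Ici_subset_Ici.2 h))

lemma mul_mem_specGE {a b : ℝ} {f g : ℝ → ℂ} (hf : f ∈ specGE a) (hg : g ∈ specGE b) :
    f * g ∈ specGE (a + b) := by
  have h := Submodule.mul_mem_mul hf hg
  unfold specGE at h
  rw [Submodule.span_mul_span] at h
  refine Submodule.span_mono ?_ h
  rintro _ ⟨_, ⟨ξ, hξ, rfl⟩, _, ⟨η, hη, rfl⟩, rfl⟩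
  refine ⟨ξ + η, Set.mem_Ici.2 (add_le_add (Set.mem_Ici.1 hξ) (Set.mem_Ici.1 hη)), funext fun x => ?_⟩
  simp only [Pi.mul_apply, ← Complex.exp_add]
  congr 1
  push_cast; ring

/-- Frequencies add under multiplication, and `m a ≥ a` since `a ≥ 0` and `m ≥ 1`. -/
lemma pow_mem_specGE {a : ℝ} (ha : 0 ≤ a) {f : ℝ → ℂ} (hf : f ∈ specGE a) {m : ℕ} (hm : 1 ≤ m) :
    f ^ m ∈ specGE a := by
  induction m, hm using Nat.le_induction with
  | base => simpa
  | succ n hn ih =>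
    rw [pow_succ]
    exact specGE_anti (by linarith) (mul_mem_specGE ih hf)

lemma conj_trig_mem_specGE {b : ℝ} {c : ℝ →₀ ℂ} (h : ∀ ξ ∈ c.support, ξ ≤ b) :
    (fun x => (starRingEnd ℂ) (trig c x)) ∈ specGE (-b) := by
  have : (fun x => (starRingEnd ℂ) (trig c x)) = ∑ ξ ∈ c.support,
      (starRingEnd ℂ) (c ξ) • fun x : ℝ => Complex.exp (Complex.I * (-ξ : ℝ) * x) := by
    funext x
    rw [trig_apply, map_sum, Finset.sum_apply]
    refine Finset.sum_congr rfl fun ξ _ => ?_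
    rw [map_mul, ← Complex.exp_conj]
    simp
  rw [this]
  refine Submodule.sum_mem _ fun ξ hξ => Submodule.smul_mem _ _ (Submodule.subset_span ?_)
  exact ⟨-ξ, neg_le_neg (h ξ hξ), rfl⟩

lemma integrable_weight_mul {v : ℝ → ℝ} (hv : Integrable v) {h : ℝ → ℂ} (hc : Continuous h)
    {B : ℝ} (hB : ∀ s, ‖h s‖ ≤ B) (x : ℝ) : Integrable fun s => (v (s - x) : ℂ) * h s :=
  ((hv.comp_sub_right x).ofReal).mul_bdd (c := B) hc.aestronglyMeasurable (.of_forall hB)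

lemma integral_weight_mul_eq_zero {δ : ℝ} {v : ℝ → ℝ} (hv : Integrable v)
    (hv0 : ∀ ξ : ℝ, δ ≤ |ξ| → ∫ t, (v t : ℂ) * Complex.exp (Complex.I * ξ * t) = 0)
    {h : ℝ → ℂ} (hh : h ∈ specGE δ) (x : ℝ) : ∫ s, (v (s - x) : ℂ) * h s = 0 := by
  obtain ⟨c, hc, rfl⟩ := mem_specGE_iff.1 hh
  simp_rw [trig_apply, Finset.mul_sum]
  rw [integral_finsetSum]
  · refine Finset.sum_eq_zero fun ξ hξ => ?_
    rw [← integral_add_right_eq_self _ x]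
    have h1 : ∀ t : ℝ, (v (t + x - x) : ℂ) * (c ξ * Complex.exp (Complex.I * ξ * (t + x : ℝ))) =
        (c ξ * Complex.exp (Complex.I * ξ * x)) * ((v t : ℂ) * Complex.exp (Complex.I * ξ * t)) := by
      intro t
      rw [add_sub_cancel_right, show Complex.I * ξ * ((t + x : ℝ) : ℂ) =
        Complex.I * ξ * t + Complex.I * ξ * x by push_cast; ring, Complex.exp_add]
      ring
    simp_rw [h1]
    rw [integral_const_mul, hv0 ξ ((hc ξ hξ).trans (le_abs_self ξ)), mul_zero]
  · intro ξ _
    refine integrable_weight_mul hv (B := ‖c ξ‖) (by fun_prop) (fun s => ?_) x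
    rw [norm_mul, norm_exp_I_mul_mul, mul_one]

lemma norm_pow_sub_pow_le (a b : ℂ) {M : ℝ} (ha : ‖a‖ ≤ M) (hb : ‖b‖ ≤ M) (m : ℕ) :
    ‖a ^ (m + 1) - b ^ (m + 1)‖ ≤ (m + 1) * ‖a - b‖ * M ^ m := by
  have hM : 0 ≤ M := (norm_nonneg a).trans ha
  induction m with
  | zero => simp
  | succ n ih =>
    have h : a ^ (n + 1 + 1) - b ^ (n + 1 + 1) =
        (a ^ (n + 1) - b ^ (n + 1)) * a + b ^ (n + 1) * (a - b) := by ring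
    rw [h]
    calc _ ≤ ‖a ^ (n + 1) - b ^ (n + 1)‖ * ‖a‖ + ‖b‖ ^ (n + 1) * ‖a - b‖ := by
          refine (norm_add_le _ _).trans ?_
          rw [norm_mul, norm_mul, norm_pow]
      _ ≤ ((n + 1) * ‖a - b‖ * M ^ n) * M + M ^ (n + 1) * ‖a - b‖ := by gcongr
      _ = _ := by push_cast; ring

/-! ### Riesz's pointwise inequality and averaging over translates -/

/-- The pointwise inequality behind M. Riesz's argument for even exponents. -/
lemma exists_pow_le_add_re (m : ℕ) :
    ∃ C : ℝ, 0 ≤ C ∧ ∀ (Φ G : ℝ) (z : ℂ), 0 ≤ Φ → 0 ≤ G → z.re = Φ - G →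
      z.im ^ 2 ≤ 4 * Φ * G → G ^ (m + 1) ≤ C * Φ ^ (m + 1) + 2 * ((-z) ^ (m + 1)).re := by
  -- `R` is chosen so that `(m + 1) · (3G/R) · (2G)^m = G^(m+1)/2` in the second case.
  set R : ℝ := 6 * (m + 1) * 2 ^ m with hR
  have hR1 : 1 ≤ R := by
    have : (1 : ℝ) ≤ 2 ^ m := one_le_pow₀ (by norm_num)
    rw [hR]
    nlinarith [(m.cast_nonneg : (0 : ℝ) ≤ m)]
  refine ⟨(R ^ 2) ^ (m + 1) + 2 * (1 + R ^ 2) ^ (m + 1), by positivity, fun Φ G z hΦ hG hre him => ?_⟩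
  have hnorm : ‖-z‖ ≤ Φ + G := by
    rw [norm_neg]
    refine abs_le_of_sq_le_sq' ?_ (by positivity) |>.2
    rw [Complex.sq_norm, Complex.normSq_apply, hre]
    nlinarith
  -- If `G ≤ R²Φ`, all terms are dominated by `Φ^(m+1)`, as `|z| ≤ Φ + G`. Otherwise `-z` is so
  -- close to `G` that `Re (-z)^(m+1) ≥ G^(m+1)/2`.
  rcases le_or_gt G (R ^ 2 * Φ) with hcase | hcase
  · have h1 : -(Φ + G) ^ (m + 1) ≤ ((-z) ^ (m + 1)).re := by
      refine (abs_le.1 ((Complex.abs_re_le_norm ((-z) ^ (m + 1))).trans ?_)).1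
      rw [norm_pow]
      exact pow_le_pow_left₀ (norm_nonneg _) hnorm _
    have h2 : G ^ (m + 1) ≤ (R ^ 2) ^ (m + 1) * Φ ^ (m + 1) := by
      rw [← mul_pow]; gcongr
    have h3 : (Φ + G) ^ (m + 1) ≤ (1 + R ^ 2) ^ (m + 1) * Φ ^ (m + 1) := by
      rw [← mul_pow]; gcongr; linarith
    linarith
  · have hR0 : 0 < R := by linarith
    have hΦG : Φ ≤ G / R := by
      rw [le_div_iff₀ hR0]
      nlinarith
    have hGG : Φ ≤ G := hΦG.trans (div_le_self hG hR1)
    have hsub : ‖-z - (G : ℂ)‖ ≤ 3 * (G / R) := by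
      have him' : |z.im| ≤ 2 * (G / R) := by
        refine abs_le_of_sq_le_sq (him.trans ?_) (by positivity)
        have : Φ ≤ G / R ^ 2 := by rw [le_div_iff₀ (by positivity)]; linarith
        calc 4 * Φ * G ≤ 4 * (G / R ^ 2) * G := by gcongr
          _ = (2 * (G / R)) ^ 2 := by field_simp; ring
      refine (Complex.norm_le_abs_re_add_abs_im _).trans ?_
      simp only [Complex.sub_re, Complex.neg_re, Complex.ofReal_re, Complex.sub_im, Complex.neg_im,
        Complex.ofReal_im, sub_zero, abs_neg, hre]
      rw [show -(Φ - G) - G = -Φ by ring, abs_neg, abs_of_nonneg hΦ]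
      linarith
    have hpow := norm_pow_sub_pow_le (-z) (G : ℂ) (M := 2 * G) (by linarith)
      (by rw [Complex.norm_real, Real.norm_of_nonneg hG]; linarith) m
    have hhalf : ‖(-z) ^ (m + 1) - (G : ℂ) ^ (m + 1)‖ ≤ G ^ (m + 1) / 2 := by
      refine hpow.trans ?_
      calc (m + 1) * ‖-z - (G : ℂ)‖ * (2 * G) ^ m ≤ (m + 1) * (3 * (G / R)) * (2 * G) ^ m := by gcongr
        _ = G ^ (m + 1) / 2 := by
          rw [hR, mul_pow]; field_simp; ring
    have h1 := (abs_le.1 ((Complex.abs_re_le_norm _).trans hhalf)).1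
    rw [Complex.sub_re, show ((G : ℂ) ^ (m + 1)).re = G ^ (m + 1) by norm_cast] at h1
    have h2 : 0 ≤ ((R ^ 2) ^ (m + 1) + 2 * (1 + R ^ 2) ^ (m + 1)) * Φ ^ (m + 1) := by positivity
    linarith

/-- Averaging a weighted inequality over translates of the weight. -/
lemma lintegral_Icc_le_of_weighted {v : ℝ → ℝ} (hv : Continuous v) {κ : ℝ}
    (hκ : ∀ t, |t| ≤ 1 → κ ≤ v t) {Γ Ψ : ℝ → ℝ≥0∞} (hΓ : Measurable Γ) (hΨ : Measurable Ψ)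
    {C B : ℝ≥0∞}
    (h : ∀ x, ∫⁻ s, ENNReal.ofReal (v (s - x)) * Γ s ≤ C * ∫⁻ s, ENNReal.ofReal (v (s - x)) * Ψ s)
    (hB : ∀ x, ∫⁻ s in Set.Icc x (x + 1), Ψ s ≤ B) (x : ℝ) :
    ENNReal.ofReal κ * ∫⁻ s in Set.Icc x (x + 1), Γ s ≤
      C * ((∫⁻ t, ENNReal.ofReal (v t)) * B) := by
  have hvm : Measurable fun t => ENNReal.ofReal (v t) := hv.measurable.ennreal_ofReal
  have hm : Measurable fun q : ℝ × ℝ => ENNReal.ofReal (v q.2) * Ψ (q.2 + q.1) :=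
    (hvm.comp measurable_snd).mul (hΨ.comp (measurable_snd.add measurable_fst))
  have hshift : ∀ y : ℝ, ∫⁻ s, ENNReal.ofReal (v (s - y)) * Ψ s =
      ∫⁻ t, ENNReal.ofReal (v t) * Ψ (t + y) := fun y => by
    rw [← lintegral_add_right_eq_self _ y]
    simp only [add_sub_cancel_right]
  calc ENNReal.ofReal κ * ∫⁻ s in Set.Icc x (x + 1), Γ s
      = ∫⁻ y in Set.Icc x (x + 1), ∫⁻ s in Set.Icc x (x + 1), ENNReal.ofReal κ * Γ s := by
        rw [lintegral_const_mul _ hΓ]; simp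
    -- Two points of the same unit interval are at distance at most one, where the weight is at
    -- least `κ`.
    _ ≤ ∫⁻ y in Set.Icc x (x + 1), ∫⁻ s, ENNReal.ofReal (v (s - y)) * Γ s := by
        refine setLIntegral_mono' measurableSet_Icc fun y hy => ?_
        refine le_trans (setLIntegral_mono' measurableSet_Icc fun s hs => ?_)
          (setLIntegral_le_lintegral _ _)
        gcongr
        exact hκ _ (abs_le.2 ⟨by linarith [hy.2, hs.1], by linarith [hy.1, hs.2]⟩)
    _ ≤ ∫⁻ y in Set.Icc x (x + 1), C * ∫⁻ t, ENNReal.ofReal (v t) * Ψ (t + y) := by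
        refine lintegral_mono fun y => ?_
        simp only
        rw [← hshift]
        exact h y
    _ = C * ∫⁻ t, ∫⁻ y in Set.Icc x (x + 1), ENNReal.ofReal (v t) * Ψ (t + y) := by
        rw [lintegral_const_mul _ hm.lintegral_prod_right', lintegral_lintegral_swap hm.aemeasurable]
    _ ≤ C * ∫⁻ t, ENNReal.ofReal (v t) * B := by
        gcongr with t
        rw [lintegral_const_mul (f := fun y => Ψ (t + y)) _ (hΨ.comp (measurable_const_add t))]
        gcongr
        simp only [add_comm t]
        rw [lintegral_Icc_comp_add_right]
        exact hB _
    _ = _ := by rw [lintegral_mul_const _ hvm]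

/-! ### Square functions and the estimate for polynomials with a spectral gap -/

/-- The square function of the first `N` members of a sequence. -/
noncomputable def partialSquareFn (N : ℕ) (f : ℕ → ℝ → ℂ) (x : ℝ) : ℝ≥0∞ :=
  (∑ j ∈ Finset.range N, ‖f j x‖ₑ ^ (2 : ℝ)) ^ (1 / 2 : ℝ)

lemma enorm_partialSquareFn_rpow (N : ℕ) (f : ℕ → ℝ → ℂ) (m : ℕ) (x : ℝ) :
    ‖partialSquareFn N f x‖ₑ ^ (2 * m : ℝ) =
      ENNReal.ofReal ((∑ j ∈ Finset.range N, ‖f j x‖ ^ 2) ^ m) := by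
  rw [enorm_eq_self, partialSquareFn, ← ENNReal.rpow_mul,
    show (1 / 2 : ℝ) * (2 * m) = m by ring, ENNReal.rpow_natCast,
    ENNReal.ofReal_pow (Finset.sum_nonneg fun _ _ => by positivity),
    ENNReal.ofReal_sum_of_nonneg fun _ _ => by positivity]
  congr 1
  refine Finset.sum_congr rfl fun j _ => ?_
  rw [ENNReal.ofReal_pow (norm_nonneg _), ofReal_norm]
  norm_cast

/-- The symbol of the modified Hilbert transform. -/
noncomputable def hilbertSymbol (σ : ℝ → ℝ) (ξ : ℝ) : ℂ := -Complex.I * (σ ξ : ℂ)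

lemma re_mul_conj_sub (a b : ℂ) :
    ((a + Complex.I * b) * (starRingEnd ℂ) (a - Complex.I * b)).re = ‖a‖ ^ 2 - ‖b‖ ^ 2 := by
  simp only [Complex.sq_norm, Complex.normSq_apply, Complex.mul_re, Complex.mul_im, Complex.conj_re,
    Complex.conj_im, Complex.add_re, Complex.add_im, Complex.sub_re, Complex.sub_im, Complex.I_re,
    Complex.I_im]
  ring

lemma im_mul_conj_sub (a b : ℂ) :
    ((a + Complex.I * b) * (starRingEnd ℂ) (a - Complex.I * b)).im =
      2 * (a * (starRingEnd ℂ) b).re := by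
  simp only [Complex.mul_re, Complex.mul_im, Complex.conj_re,
    Complex.conj_im, Complex.add_re, Complex.add_im, Complex.sub_re, Complex.sub_im, Complex.I_re,
    Complex.I_im]
  ring

/-- The analytic part `f + i H f` of a trigonometric polynomial. -/
lemma add_hilbert_mem_specGE {σ : ℝ → ℝ} (hσ : ∀ ξ, σ ξ = 1 ∨ σ ξ = -1) {a : ℝ} {c : ℝ →₀ ℂ}
    (h : ∀ ξ ∈ c.support, σ ξ = 1 → a ≤ ξ) :
    (fun x => trig c x + Complex.I * trig (hilbertSymbol σ • c) x) ∈ specGE a := by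
  have : (fun x => trig c x + Complex.I * trig (hilbertSymbol σ • c) x) =
      trig (c + Complex.I • (hilbertSymbol σ • c)) := by
    funext x; simp
  rw [this]
  refine trig_mem_specGE fun ξ hξ => ?_
  -- The factor `1 + σ ξ` kills exactly the frequencies of sign `-1`.
  have hval : (c + Complex.I • (hilbertSymbol σ • c)) ξ = (1 + σ ξ) * c ξ := by
    simp only [Finsupp.add_apply, Finsupp.smul_apply, Finsupp.coe_pointwise_smul, Pi.smul_apply',
      smul_eq_mul, hilbertSymbol]
    linear_combination (-(σ ξ : ℂ) * c ξ) * Complex.I_mul_I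
  rw [Finsupp.mem_support_iff, hval] at hξ
  rcases hσ ξ with h1 | h1
  · exact h ξ (Finsupp.mem_support_iff.2 (right_ne_zero_of_mul hξ)) h1
  · simp [h1] at hξ

/-- The conjugate of the anti-analytic part `f - i H f` of a trigonometric polynomial. -/
lemma conj_sub_hilbert_mem_specGE {σ : ℝ → ℝ} (hσ : ∀ ξ, σ ξ = 1 ∨ σ ξ = -1) {b : ℝ} {c : ℝ →₀ ℂ}
    (h : ∀ ξ ∈ c.support, σ ξ = -1 → ξ ≤ b) :
    (fun x => (starRingEnd ℂ) (trig c x - Complex.I * trig (hilbertSymbol σ • c) x)) ∈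
      specGE (-b) := by
  have : (fun x => (starRingEnd ℂ) (trig c x - Complex.I * trig (hilbertSymbol σ • c) x)) =
      fun x => (starRingEnd ℂ) (trig (c - Complex.I • (hilbertSymbol σ • c)) x) := by
    funext x; simp
  rw [this]
  refine conj_trig_mem_specGE fun ξ hξ => ?_
  have hval : (c - Complex.I • (hilbertSymbol σ • c)) ξ = (1 - σ ξ) * c ξ := by
    simp only [Finsupp.sub_apply, Finsupp.smul_apply, Finsupp.coe_pointwise_smul, Pi.smul_apply',
      smul_eq_mul, hilbertSymbol]
    linear_combination ((σ ξ : ℂ) * c ξ) * Complex.I_mul_I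
  rw [Finsupp.mem_support_iff, hval] at hξ
  rcases hσ ξ with h1 | h1
  · simp [h1] at hξ
  · exact h ξ (Finsupp.mem_support_iff.2 (right_ne_zero_of_mul hξ)) h1

lemma integrable_weight_mul_pow {v : ℝ → ℝ} (hv : Integrable v) (m N : ℕ) (c : ℕ → ℝ →₀ ℂ)
    (x : ℝ) : Integrable fun s => v (s - x) * (∑ j ∈ Finset.range N, ‖trig (c j) s‖ ^ 2) ^ m := by
  refine (hv.comp_sub_right x).mul_bdd
    (c := (∑ j ∈ Finset.range N, (∑ ξ ∈ (c j).support, ‖c j ξ‖) ^ 2) ^ m) ?_ (.of_forall fun s => ?_)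
  · have : ∀ j, Continuous (trig (c j)) := fun j => continuous_trig _
    exact Continuous.aestronglyMeasurable (by fun_prop)
  · have h0 : 0 ≤ ∑ j ∈ Finset.range N, ‖trig (c j) s‖ ^ 2 :=
      Finset.sum_nonneg fun _ _ => by positivity
    rw [Real.norm_of_nonneg (by positivity)]
    gcongr
    exact norm_trig_le _ _

/-- The vector-valued weighted inequality for trigonometric polynomials with a spectral gap. -/
lemma integral_weight_hilbert_le {δ : ℝ} (hδ : 0 < δ) {v : ℝ → ℝ} (hv0 : ∀ t, 0 ≤ v t)
    (hv : Integrable v)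
    (hvs : ∀ ξ : ℝ, δ ≤ |ξ| → ∫ t, (v t : ℂ) * Complex.exp (Complex.I * ξ * t) = 0)
    {m : ℕ} {C : ℝ} (hC : ∀ (Φ G : ℝ) (z : ℂ), 0 ≤ Φ → 0 ≤ G → z.re = Φ - G →
      z.im ^ 2 ≤ 4 * Φ * G → G ^ (m + 1) ≤ C * Φ ^ (m + 1) + 2 * ((-z) ^ (m + 1)).re)
    {σ : ℝ → ℝ} (hσ : ∀ ξ, σ ξ = 1 ∨ σ ξ = -1) {a : ℝ} (N : ℕ) {c : ℕ → ℝ →₀ ℂ}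
    (hc : ∀ j, ∀ ξ ∈ (c j).support, (σ ξ = 1 → a ≤ ξ) ∧ (σ ξ = -1 → ξ ≤ a - δ)) (x : ℝ) :
    ∫ s, v (s - x) *
        (∑ j ∈ Finset.range N, ‖trig (hilbertSymbol σ • c j) s‖ ^ 2) ^ (m + 1) ≤
      C * ∫ s, v (s - x) * (∑ j ∈ Finset.range N, ‖trig (c j) s‖ ^ 2) ^ (m + 1) := by
  set f : ℕ → ℝ → ℂ := fun j => trig (c j) with hf
  set g : ℕ → ℝ → ℂ := fun j => trig (hilbertSymbol σ • c j) with hg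
  set z : ℝ → ℂ := ∑ j ∈ Finset.range N, (fun x => f j x + Complex.I * g j x) *
    fun x => (starRingEnd ℂ) (f j x - Complex.I * g j x) with hz
  -- The unknown position `a` of the gap cancels in the product; only its length `δ` remains.
  have hzs : z ∈ specGE δ := Submodule.sum_mem _ fun j _ => by
    have := mul_mem_specGE (add_hilbert_mem_specGE hσ fun ξ hξ => (hc j ξ hξ).1)
      (conj_sub_hilbert_mem_specGE hσ fun ξ hξ => (hc j ξ hξ).2)
    rwa [show a + -(a - δ) = δ by ring] at this
  have hnz : -z ∈ specGE δ := Submodule.neg_mem _ hzs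
  have hpow := pow_mem_specGE hδ.le hnz (Nat.le_add_left 1 m)
  have hint0 := integral_weight_mul_eq_zero hv hvs hpow x
  have hzint : Integrable fun s => (v (s - x) : ℂ) * ((-z) ^ (m + 1)) s := by
    obtain ⟨d, -, hd⟩ := mem_specGE_iff.1 hpow
    rw [← hd]
    exact integrable_weight_mul hv (continuous_trig d) (norm_trig_le d) x
  have hre0 : ∫ s, v (s - x) * ((-z s) ^ (m + 1)).re = 0 := by
    have h1 := integral_re hzint
    simp only [RCLike.re_to_complex, Complex.re_ofReal_mul, hint0, Complex.zero_re] at h1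
    simpa using h1
  have hreint : Integrable fun s => v (s - x) * ((-z s) ^ (m + 1)).re := by
    have h1 := hzint.re
    simp only [RCLike.re_to_complex, Complex.re_ofReal_mul] at h1
    simpa using h1
  have hzre : ∀ s, (z s).re = (∑ j ∈ Finset.range N, ‖f j s‖ ^ 2) -
      ∑ j ∈ Finset.range N, ‖g j s‖ ^ 2 := fun s => by
    rw [hz, Finset.sum_apply, Complex.re_sum, ← Finset.sum_sub_distrib]
    exact Finset.sum_congr rfl fun j _ => re_mul_conj_sub _ _
  -- Cauchy–Schwarz in `j`; this is where the `ℓ²` structure enters.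
  have hzim : ∀ s, (z s).im ^ 2 ≤ 4 * (∑ j ∈ Finset.range N, ‖f j s‖ ^ 2) *
      ∑ j ∈ Finset.range N, ‖g j s‖ ^ 2 := fun s => by
    have h1 : (z s).im = 2 * ∑ j ∈ Finset.range N, (f j s * (starRingEnd ℂ) (g j s)).re := by
      rw [hz, Finset.sum_apply, Complex.im_sum, Finset.mul_sum]
      exact Finset.sum_congr rfl fun j _ => im_mul_conj_sub _ _
    have h2 : |∑ j ∈ Finset.range N, (f j s * (starRingEnd ℂ) (g j s)).re| ≤
        ∑ j ∈ Finset.range N, ‖f j s‖ * ‖g j s‖ := by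
      refine (Finset.abs_sum_le_sum_abs _ _).trans (Finset.sum_le_sum fun j _ => ?_)
      refine (Complex.abs_re_le_norm _).trans (le_of_eq ?_)
      rw [norm_mul, RCLike.norm_conj]
    have h3 := Finset.sum_mul_sq_le_sq_mul_sq (Finset.range N) (fun j => ‖f j s‖) fun j => ‖g j s‖
    have h4 := sq_le_sq' (abs_le.1 h2).1 (abs_le.1 h2).2
    rw [h1, mul_pow]
    linarith
  have hfi := integrable_weight_mul_pow hv (m + 1) N c x
  have hgi := integrable_weight_mul_pow hv (m + 1) N (fun j => hilbertSymbol σ • c j) x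
  calc _ ≤ ∫ s, (C * (v (s - x) * (∑ j ∈ Finset.range N, ‖f j s‖ ^ 2) ^ (m + 1)) +
        2 * (v (s - x) * ((-z s) ^ (m + 1)).re)) := by
        refine integral_mono hgi ((hfi.const_mul C).add (hreint.const_mul 2)) fun s => ?_
        have h1 := mul_le_mul_of_nonneg_left (hC _ _ (z s)
          (Finset.sum_nonneg fun j _ => by positivity)
          (Finset.sum_nonneg fun j _ => by positivity) (hzre s) (hzim s)) (hv0 (s - x))
        simp only
        linarith
    _ = _ := by
        rw [integral_add (hfi.const_mul C) (hreint.const_mul 2), integral_const_mul,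
          integral_const_mul, hre0]
        simp

/-- The square function estimate for trigonometric polynomials with a spectral gap. -/
lemma exists_stepNorm_hilbert_trig_le (m : ℕ) {δ : ℝ} (hδ : 0 < δ) :
    ∃ K : ℝ≥0, ∀ (σ : ℝ → ℝ) (a : ℝ) (N : ℕ) (c : ℕ → ℝ →₀ ℂ), (∀ ξ, σ ξ = 1 ∨ σ ξ = -1) →
      (∀ j, ∀ ξ ∈ (c j).support, (σ ξ = 1 → a ≤ ξ) ∧ (σ ξ = -1 → ξ ≤ a - δ)) →
      stepNorm (2 * (m + 1 : ℕ)) (partialSquareFn N fun j => trig (hilbertSymbol σ • c j)) ≤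
        K * stepNorm (2 * (m + 1 : ℕ)) (partialSquareFn N fun j => trig (c j)) := by
  obtain ⟨v, hvc, hv0, hvi, ⟨κ, hκ0, hκ⟩, hvs⟩ := exists_bandlimited_weight hδ
  obtain ⟨C, hC0, hC⟩ := exists_pow_le_add_re m
  set p : ℝ := 2 * (m + 1 : ℕ) with hp
  have hp0 : 0 < p := by positivity
  set A : ℝ≥0∞ := (ENNReal.ofReal κ)⁻¹ * (ENNReal.ofReal C * ∫⁻ t, ENNReal.ofReal (v t)) with hA
  have hκne : ENNReal.ofReal κ ≠ 0 := by simpa using hκ0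
  have hvt : ∫⁻ t, ENNReal.ofReal (v t) ≠ ∞ := by
    rw [← ofReal_integral_eq_lintegral_ofReal hvi (.of_forall hv0)]
    exact ENNReal.ofReal_ne_top
  have hAt : A ≠ ∞ := ENNReal.mul_ne_top (ENNReal.inv_ne_top.2 hκne)
    (ENNReal.mul_ne_top ENNReal.ofReal_ne_top hvt)
  have hAt' : A ^ (1 / p) ≠ ∞ := ENNReal.rpow_ne_top_of_nonneg (by positivity) hAt
  refine ⟨(A ^ (1 / p)).toNNReal, fun σ a N c hσ hc => ?_⟩
  rw [ENNReal.coe_toNNReal hAt']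
  set f : ℕ → ℝ → ℂ := fun j => trig (c j)
  set g : ℕ → ℝ → ℂ := fun j => trig (hilbertSymbol σ • c j)
  have hmeas : ∀ d : ℕ → ℝ →₀ ℂ, Measurable fun s =>
      ENNReal.ofReal ((∑ j ∈ Finset.range N, ‖trig (d j) s‖ ^ 2) ^ (m + 1)) := fun d => by
    have : ∀ j, Continuous (trig (d j)) := fun j => continuous_trig _
    exact Measurable.ennreal_ofReal (Continuous.measurable (by fun_prop))
  have hconv : ∀ (d : ℕ → ℝ →₀ ℂ) (x : ℝ), ∫⁻ s, ENNReal.ofReal (v (s - x)) *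
      ENNReal.ofReal ((∑ j ∈ Finset.range N, ‖trig (d j) s‖ ^ 2) ^ (m + 1)) =
      ENNReal.ofReal (∫ s, v (s - x) *
        (∑ j ∈ Finset.range N, ‖trig (d j) s‖ ^ 2) ^ (m + 1)) := fun d x => by
    rw [ofReal_integral_eq_lintegral_ofReal (integrable_weight_mul_pow hvi _ N d x)]
    · refine lintegral_congr fun s => ?_
      rw [ENNReal.ofReal_mul (hv0 _)]
    · refine .of_forall fun s => mul_nonneg (hv0 _) ?_
      exact pow_nonneg (Finset.sum_nonneg fun j _ => by positivity) _
  refine stepNorm_le_of_lintegral_le hp0 fun x => ?_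
  have key := lintegral_Icc_le_of_weighted hvc hκ (hmeas fun j => hilbertSymbol σ • c j)
    (hmeas c) (C := ENNReal.ofReal C) (B := stepNorm p (partialSquareFn N f) ^ p)
    (fun y => by
      rw [hconv, hconv, ← ENNReal.ofReal_mul hC0]
      exact ENNReal.ofReal_le_ofReal (integral_weight_hilbert_le hδ hv0 hvi hvs hC hσ N hc y))
    (fun y => by
      refine le_trans (le_of_eq (lintegral_congr fun s => ?_))
        (lintegral_le_stepNorm_rpow hp0 (partialSquareFn N f) y)
      rw [hp, enorm_partialSquareFn_rpow]) x
  calc ∫⁻ s in Set.Icc x (x + 1), ‖partialSquareFn N g s‖ₑ ^ p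
      = ∫⁻ s in Set.Icc x (x + 1),
        ENNReal.ofReal ((∑ j ∈ Finset.range N, ‖g j s‖ ^ 2) ^ (m + 1)) := by
        refine lintegral_congr fun s => ?_
        rw [hp, enorm_partialSquareFn_rpow]
    _ = (ENNReal.ofReal κ)⁻¹ * (ENNReal.ofReal κ * ∫⁻ s in Set.Icc x (x + 1),
        ENNReal.ofReal ((∑ j ∈ Finset.range N, ‖g j s‖ ^ 2) ^ (m + 1))) := by
        rw [← mul_assoc, ENNReal.inv_mul_cancel hκne ENNReal.ofReal_ne_top, one_mul]
    _ ≤ (ENNReal.ofReal κ)⁻¹ * (ENNReal.ofReal C * ((∫⁻ t, ENNReal.ofReal (v t)) *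
        stepNorm p (partialSquareFn N f) ^ p)) := by gcongr
    _ = (A ^ (1 / p) * stepNorm p (partialSquareFn N f)) ^ p := by
        rw [ENNReal.mul_rpow_of_nonneg _ _ hp0.le, ← ENNReal.rpow_mul, one_div_mul_cancel hp0.ne',
          ENNReal.rpow_one, hA]
        ring

/-! ### From separation to approximants with a spectral gap -/

lemma Separated.lt_two_mul_abs {α : ℝ} {f : ℝ → ℂ} (h : Separated α f) {ξ : ℝ} (hξ : ξ ≠ 0)
    (hf : fourierCoeff f ξ ≠ 0) : α < 2 * |ξ| := by
  have h1 : ξ ∈ exponents f := Or.inl hf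
  have h2 : -ξ ∈ exponents f := Or.inr (by simpa using hf)
  rcases lt_or_gt_of_ne hξ with h0 | h0
  · have := h ξ h1 (-ξ) h2 (by linarith)
    rw [abs_of_neg h0]; linarith
  · have := h (-ξ) h2 ξ h1 (by linarith)
    rw [abs_of_pos h0]; linarith

lemma Approx.congr_ae {p : ℝ} (hp : 0 < p) {f g : ℝ → ℂ} {c : ℕ → ℝ →₀ ℂ} (h : Approx p f c)
    (hg : AEStronglyMeasurable g volume) (hfg : f =ᵐ[volume] g) : Approx p g c :=
  ⟨hg, h.2.congr fun _ => stepNorm_congr_ae hp (hfg.sub .rfl)⟩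

lemma Approx.fourierCoeff_smul {p : ℝ} (hp : 1 ≤ p) {f g : ℝ → ℂ} {c : ℕ → ℝ →₀ ℂ} {s : ℝ → ℂ}
    (hf : Approx p f c) (hg : Approx p g fun n => s • c n) (ξ : ℝ) :
    fourierCoeff g ξ = s ξ * fourierCoeff f ξ :=
  tendsto_nhds_unique (hg.tendsto_apply hp ξ) ((hf.tendsto_apply hp ξ).const_mul (s ξ))

/-- A multiplier bounded on differences of the approximants maps them to a Cauchy sequence; it
serves both for the low-pass convolution and for the Hilbert transform. -/
lemma Approx.exists_smul {p : ℝ} (hp : 1 ≤ p) {f : ℝ → ℂ} {c : ℕ → ℝ →₀ ℂ} {s : ℝ → ℂ}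
    (hf : Approx p f c) {K : ℝ≥0∞} (hK : K ≠ ∞)
    (hs : ∀ n m, stepNorm p (trig (s • (c n - c m))) ≤ K * stepNorm p (trig (c n - c m))) :
    ∃ g, Approx p g fun n => s • c n := by
  refine exists_approx_of_cauchy hp fun ε hε => ?_
  -- The added `1` covers the case `K = 0`.
  obtain ⟨N, hN⟩ := hf.cauchy hp (ε / (K + 1)) (ENNReal.div_pos hε.ne' (by finiteness))
  refine ⟨N, fun n hn m hm => ?_⟩
  rw [show s • c n - s • c m = s • (c n - c m) by ext; simp [mul_sub]]
  refine (hs n m).trans_lt ?_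
  have h1 := hN n hn m hm
  rw [ENNReal.lt_div_iff_mul_lt (by simp) (by simp [hK]), mul_comm] at h1
  refine lt_of_le_of_lt ?_ h1
  gcongr
  exact le_self_add

/-- A function whose spectrum avoids a punctured neighbourhood of the origin is a limit of
trigonometric polynomials with the same property. -/
lemma Approx.exists_gap {p : ℝ} (hp : 2 ≤ p) {α : ℝ} (hα : 0 < α) {f : ℝ → ℂ} {c : ℕ → ℝ →₀ ℂ}
    (hf : Approx p f c) (hsep : Separated α f) :
    ∃ d, Approx p f d ∧ ∀ n, ∀ ξ ∈ (d n).support, ξ = 0 ∨ α / 4 ≤ |ξ| := by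
  have hp1 : 1 ≤ p := by linarith
  have hp0 : 0 < p := by linarith
  -- The symbol is `1` on `|ξ| ≤ α/4` and `0` on `|ξ| ≥ α/2`, and all nonzero exponents of `f` lie
  -- in the latter region. So the convolution has the coefficients of the constant `e`.
  obtain ⟨k, hkc, hki, hk1, hk0⟩ := exists_low_pass_kernel (half_pos hα)
  obtain ⟨h, hh⟩ := hf.exists_smul hp1 (s := symbol k) hki.2.ne
    fun n m => stepNorm_trig_symbol_smul_le hp1 hki hkc _
  set e : ℝ →₀ ℂ := Finsupp.single 0 (fourierCoeff f 0) with he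
  have hconst : h =ᵐ[volume] trig e := by
    refine hh.ae_eq hp (approx_trig hp0 e) fun ξ => ?_
    rw [hf.fourierCoeff_smul hp1 hh, show fourierCoeff (trig e) ξ = e ξ from
      tendsto_nhds_unique ((approx_trig hp0 e).tendsto_apply hp1 ξ) tendsto_const_nhds]
    by_cases h0 : ξ = 0
    · rw [h0, he, Finsupp.single_eq_same, symbol, hk1 0 (by simpa using by positivity), one_mul]
    · rw [he, Finsupp.single_eq_of_ne h0]
      by_cases hz : fourierCoeff f ξ = 0
      · rw [hz, mul_zero]
      · rw [symbol, hk0 ξ (by linarith [hsep.lt_two_mul_abs h0 hz]), zero_mul]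
  have hs := hf.sub hp1 (hh.congr_ae hp0 (aestronglyMeasurable_trig e) hconst)
  -- Subtracting the low-pass part removes every frequency below `α/4`; adding `e` restores the mean
  -- value at frequency `0`.
  refine ⟨fun n => c n - symbol k • c n + e, ⟨hf.1, hs.2.congr fun n => ?_⟩, fun n ξ hξ => ?_⟩
  · congr 1
    rw [map_add]
    abel
  · by_contra! hcon
    refine Finsupp.mem_support_iff.1 hξ ?_
    have h1 : symbol k ξ = 1 := hk1 ξ (by linarith [hcon.2])
    simp [he, h1, hcon.1]

/-- The frequency `0` joins the positive side for `sgnPlus`, giving `a = 0`, and the negative side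
for `sgnMinus`, giving `a = δ`. -/
lemma sgn_gap {σ : ℝ → ℝ} (hσ : σ = sgnPlus ∨ σ = sgnMinus) {δ : ℝ} :
    (∀ ξ, σ ξ = 1 ∨ σ ξ = -1) ∧ ∃ a, ∀ ξ, (ξ = 0 ∨ δ ≤ |ξ|) →
      (σ ξ = 1 → a ≤ ξ) ∧ (σ ξ = -1 → ξ ≤ a - δ) := by
  rcases hσ with rfl | rfl
  · refine ⟨fun ξ => by unfold sgnPlus; split_ifs <;> simp, 0, fun ξ hξ => ?_⟩
    unfold sgnPlus
    split_ifs with h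
    · exact ⟨fun _ => h, fun h => by norm_num at h⟩
    · refine ⟨fun h => by norm_num at h, fun _ => ?_⟩
      rcases hξ with rfl | hξ
      · simp at h
      · rw [abs_of_neg (not_le.1 h)] at hξ; linarith
  · refine ⟨fun ξ => by unfold sgnMinus; split_ifs <;> simp, δ, fun ξ hξ => ?_⟩
    unfold sgnMinus
    split_ifs with h
    · refine ⟨fun _ => ?_, fun h => by norm_num at h⟩
      rcases hξ with rfl | hξ
      · simp at h
      · rwa [abs_of_pos h] at hξ
    · exact ⟨fun h => by norm_num at h, fun _ => by simpa using h⟩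

/-! ### Passage to limits in the square function estimate -/

lemma aestronglyMeasurable_partialSquareFn {N : ℕ} {f : ℕ → ℝ → ℂ}
    (hf : ∀ j, AEStronglyMeasurable (f j) volume) :
    AEStronglyMeasurable (partialSquareFn N f) volume := by
  refine AEMeasurable.aestronglyMeasurable ?_
  refine AEMeasurable.pow_const ?_ _
  exact Finset.aemeasurable_fun_sum _ fun j _ => (hf j).enorm.pow_const _

/-- Minkowski's inequality in `ℓ²`, followed by the bound of the `ℓ²` norm by the `ℓ¹` norm. The
crude `ℓ¹` error is harmless because `N` is fixed while the approximation improves. -/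
lemma partialSquareFn_le_add (N : ℕ) (u w : ℕ → ℝ → ℂ) (x : ℝ) :
    partialSquareFn N u x ≤
      partialSquareFn N w x + ∑ j ∈ Finset.range N, ‖u j x - w j x‖ₑ := by
  have h1 : (∑ j ∈ Finset.range N, ‖u j x - w j x‖ₑ ^ (2 : ℝ)) ^ (1 / 2 : ℝ) ≤
      ∑ j ∈ Finset.range N, ‖u j x - w j x‖ₑ := by
    have h2 : ∑ j ∈ Finset.range N, ‖u j x - w j x‖ₑ ^ (2 : ℝ) ≤
        (∑ j ∈ Finset.range N, ‖u j x - w j x‖ₑ) ^ (2 : ℝ) := by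
      induction N with
      | zero => simp
      | succ n ih =>
        rw [Finset.sum_range_succ, Finset.sum_range_succ]
        refine le_trans (by gcongr) (ENNReal.add_rpow_le_rpow_add _ _ one_le_two)
    calc _ ≤ ((∑ j ∈ Finset.range N, ‖u j x - w j x‖ₑ) ^ (2 : ℝ)) ^ (1 / 2 : ℝ) := by gcongr
      _ = _ := by rw [← ENNReal.rpow_mul]; norm_num
  calc partialSquareFn N u x
      ≤ (∑ j ∈ Finset.range N, (‖w j x‖ₑ + ‖u j x - w j x‖ₑ) ^ (2 : ℝ)) ^ (1 / 2 : ℝ) := by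
        unfold partialSquareFn
        gcongr with j _
        calc ‖u j x‖ₑ = ‖w j x + (u j x - w j x)‖ₑ := by simp
          _ ≤ _ := enorm_add_le _ _
    _ ≤ partialSquareFn N w x +
        (∑ j ∈ Finset.range N, ‖u j x - w j x‖ₑ ^ (2 : ℝ)) ^ (1 / 2 : ℝ) :=
        ENNReal.Lp_add_le _ _ _ one_le_two
    _ ≤ _ := by gcongr

lemma stepNorm_sum_enorm_le {p : ℝ} (hp : 1 ≤ p) (N : ℕ) {f : ℕ → ℝ → ℂ}
    (hf : ∀ j, AEStronglyMeasurable (f j) volume) :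
    stepNorm p (fun x => ∑ j ∈ Finset.range N, ‖f j x‖ₑ) ≤ ∑ j ∈ Finset.range N, stepNorm p (f j) := by
  have hp0 : 0 < p := by linarith
  have he : ∀ j, stepNorm p (fun x => ‖f j x‖ₑ) = stepNorm p (f j) := fun j =>
    stepNorm_congr hp0 (.of_forall fun x => by simp)
  induction N with
  | zero => exact stepNorm_le_of_lintegral_le hp0 fun x => by simp [hp0]
  | succ n ih =>
    simp_rw [Finset.sum_range_succ]
    refine (stepNorm_add_le (f := fun x => ∑ j ∈ Finset.range n, ‖f j x‖ₑ) hp ?_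
      (hf n).enorm.aestronglyMeasurable).trans ?_
    · exact (Finset.aemeasurable_fun_sum _ fun j _ => (hf j).enorm).aestronglyMeasurable
    · rw [he]; gcongr

lemma stepNorm_partialSquareFn_le {p : ℝ} (hp : 1 ≤ p) (N : ℕ) {u w : ℕ → ℝ → ℂ}
    (hu : ∀ j, AEStronglyMeasurable (u j) volume) (hw : ∀ j, AEStronglyMeasurable (w j) volume) :
    stepNorm p (partialSquareFn N u) ≤
      stepNorm p (partialSquareFn N w) + ∑ j ∈ Finset.range N, stepNorm p (u j - w j) := by
  have hs := fun j => (hu j).sub (hw j)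
  calc stepNorm p (partialSquareFn N u)
      ≤ stepNorm p (partialSquareFn N w +
        fun x => ∑ j ∈ Finset.range N, ‖(u j - w j) x‖ₑ) :=
        stepNorm_mono (by linarith) (.of_forall fun x => partialSquareFn_le_add N u w x)
    _ ≤ _ := stepNorm_add_le hp (aestronglyMeasurable_partialSquareFn hw)
        (Finset.aemeasurable_fun_sum _ fun j _ => (hs j).enorm).aestronglyMeasurable
    _ ≤ _ := by gcongr; exact stepNorm_sum_enorm_le hp N hs

lemma partialSquareFn_mono (f : ℕ → ℝ → ℂ) (x : ℝ) : Monotone fun N => partialSquareFn N f x := by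
  intro N M h
  exact ENNReal.rpow_le_rpow (Finset.sum_le_sum_of_subset (Finset.range_mono h)) (by norm_num)

lemma partialSquareFn_le_squareFn (N : ℕ) (f : ℕ → ℝ → ℂ) (x : ℝ) :
    partialSquareFn N f x ≤ squareFn f x := by
  unfold partialSquareFn squareFn
  gcongr
  exact ENNReal.sum_le_tsum _

lemma tendsto_partialSquareFn (f : ℕ → ℝ → ℂ) (x : ℝ) :
    Tendsto (fun N => partialSquareFn N f x) atTop (𝓝 (squareFn f x)) :=
  (ENNReal.continuous_rpow_const.tendsto _).comp ENNReal.summable.hasSum.tendsto_sum_nat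

/-- Monotone convergence on each unit interval, with a bound independent of the interval. -/
lemma stepNorm_squareFn_le {p : ℝ} (hp : 0 < p) {f : ℕ → ℝ → ℂ}
    (hf : ∀ j, AEStronglyMeasurable (f j) volume) {B : ℝ≥0∞}
    (h : ∀ N, stepNorm p (partialSquareFn N f) ≤ B) : stepNorm p (squareFn f) ≤ B := by
  refine stepNorm_le_of_lintegral_le hp fun x => ?_
  have hlim : Tendsto
      (fun N => ∫⁻ s in Set.Icc x (x + 1), ‖partialSquareFn N f s‖ₑ ^ p) atTop
      (𝓝 (∫⁻ s in Set.Icc x (x + 1), ‖squareFn f s‖ₑ ^ p)) := by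
    refine lintegral_tendsto_of_tendsto_of_monotone (fun N => ?_) (.of_forall fun s => ?_)
      (.of_forall fun s => ?_)
    · exact (aestronglyMeasurable_partialSquareFn hf).restrict.enorm.pow_const p
    · intro N M hNM
      simp only [enorm_eq_self]
      exact ENNReal.rpow_le_rpow (partialSquareFn_mono f s hNM) hp.le
    · simp only [enorm_eq_self]
      exact (ENNReal.continuous_rpow_const.tendsto _).comp (tendsto_partialSquareFn f s)
  refine le_of_tendsto' hlim fun N => ?_
  exact (lintegral_le_stepNorm_rpow hp _ x).trans (ENNReal.rpow_le_rpow (h N) hp.le)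

lemma stepNorm_partialSquareFn_one {p : ℝ} (hp : 0 < p) (f : ℕ → ℝ → ℂ) :
    stepNorm p (partialSquareFn 1 f) = stepNorm p (f 0) := by
  refine stepNorm_congr hp (.of_forall fun x => ?_)
  rw [enorm_eq_self, partialSquareFn, Finset.sum_range_one, ← ENNReal.rpow_mul]
  norm_num

/-- Passage to the limit in the square function estimate. -/
lemma stepNorm_partialSquareFn_le_of_approx {p : ℝ} (hp : 1 ≤ p) (N : ℕ) {f g : ℕ → ℝ → ℂ}
    {c d : ℕ → ℕ → ℝ →₀ ℂ} (hf : ∀ j, Approx p (f j) (c j)) (hg : ∀ j, Approx p (g j) (d j))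
    {K : ℝ≥0} (h : ∀ n, stepNorm p (partialSquareFn N fun j => trig (d j n)) ≤
      K * stepNorm p (partialSquareFn N fun j => trig (c j n))) :
    stepNorm p (partialSquareFn N g) ≤ K * stepNorm p (partialSquareFn N f) := by
  have hp0 : 0 < p := by linarith
  have htrig : ∀ (c : ℕ → ℕ → ℝ →₀ ℂ) n j, AEStronglyMeasurable (trig (c j n)) volume :=
    fun c n j => aestronglyMeasurable_trig _
  have hlim : Tendsto (fun n => K * (stepNorm p (partialSquareFn N f) +
      ∑ j ∈ Finset.range N, stepNorm p (f j - trig (c j n))) +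
      ∑ j ∈ Finset.range N, stepNorm p (g j - trig (d j n))) atTop
      (𝓝 (K * (stepNorm p (partialSquareFn N f) + ∑ j ∈ Finset.range N, 0) +
        ∑ j ∈ Finset.range N, 0)) := by
    refine (ENNReal.Tendsto.const_mul (tendsto_const_nhds.add
      (tendsto_finsetSum _ fun j _ => (hf j).2)) (Or.inr ENNReal.coe_ne_top)).add
      (tendsto_finsetSum _ fun j _ => (hg j).2)
  simp only [Finset.sum_const_zero, add_zero] at hlim
  refine ge_of_tendsto' hlim fun n => ?_
  refine (stepNorm_partialSquareFn_le hp N (fun j => (hg j).1) (htrig d n)).trans ?_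
  gcongr
  refine (h n).trans ?_
  gcongr
  refine (stepNorm_partialSquareFn_le hp N (htrig c n) fun j => (hf j).1).trans ?_
  gcongr with j _
  rw [stepNorm_sub_comm hp0]

end Stepanov

/-! ### Proof of the theorem -/

theorem theorem3p4 (k : ℕ) (hk : 1 ≤ k) (α : ℝ) (hα : 0 < α) :
    ∃ C : ℝ≥0, ∀ σ : ℝ → ℝ, (σ = Stepanov.sgnPlus ∨ σ = Stepanov.sgnMinus) →
      ∀ f : ℕ → ℝ → ℂ, (∀ j, Stepanov.Mem ((2 : ℝ) ^ k) (f j)) →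
        (∀ j, Stepanov.Separated α (f j)) →
        (∀ j, ∃ g : ℝ → ℂ, Stepanov.IsHilbertTransform σ ((2 : ℝ) ^ k) (f j) g ∧
          ∀ g' : ℝ → ℂ, Stepanov.IsHilbertTransform σ ((2 : ℝ) ^ k) (f j) g' →
            g' =ᵐ[volume] g) ∧
        ∀ g : ℕ → ℝ → ℂ, (∀ j, Stepanov.IsHilbertTransform σ ((2 : ℝ) ^ k) (f j) (g j)) →
          Stepanov.stepNorm ((2 : ℝ) ^ k) (Stepanov.squareFn g) ≤
            C * Stepanov.stepNorm ((2 : ℝ) ^ k) (Stepanov.squareFn f) := by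
  open Stepanov in
  have hδ : 0 < α / 4 := by positivity
  -- The power of two matters only as an even integer `2(m + 1)`.
  obtain ⟨m, hm⟩ : ∃ m : ℕ, (2 : ℝ) ^ k = 2 * (m + 1 : ℕ) := by
    refine ⟨2 ^ (k - 1) - 1, ?_⟩
    rw [Nat.sub_add_cancel Nat.one_le_two_pow, Nat.cast_pow, Nat.cast_ofNat, ← pow_succ',
      Nat.sub_add_cancel hk]
  obtain ⟨K, hK⟩ := exists_stepNorm_hilbert_trig_le m hδ
  rw [← hm] at hK
  have hp : (2 : ℝ) ≤ 2 ^ k := by simpa using pow_le_pow_right₀ (one_le_two (α := ℝ)) hk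
  set p : ℝ := 2 ^ k
  have hp1 : 1 ≤ p := by linarith
  have hp0 : 0 < p := by linarith
  refine ⟨K, fun σ hσ f hf hsep => ?_⟩
  obtain ⟨hσ1, a, ha⟩ := sgn_gap (δ := α / 4) hσ
  have hgap : ∀ j, ∃ d, Approx p (f j) d ∧ ∀ n, ∀ ξ ∈ (d n).support, ξ = 0 ∨ α / 4 ≤ |ξ| := fun j => by
    obtain ⟨c, hc⟩ := (hf j).exists_approx
    exact hc.exists_gap hp hα (hsep j)
  choose d hd hdgap using hgap
  have hex : ∀ j, ∃ g, Approx p g fun n => hilbertSymbol σ • d j n := fun j => by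
    refine (hd j).exists_smul hp1 (K := K) ENNReal.coe_ne_top fun n m => ?_
    -- The case `N = 1`, applied to differences of approximants, which inherit the gap, is the
    -- scalar bound needed for the existence of `H f_j`.
    have h := hK σ a 1 (fun _ => d j n - d j m) hσ1 fun _ ξ hξ => ha ξ ?_
    · rwa [stepNorm_partialSquareFn_one hp0, stepNorm_partialSquareFn_one hp0] at h
    · rcases Finset.mem_union.1 (Finsupp.support_sub hξ) with h | h
      exacts [hdgap j n ξ h, hdgap j m ξ h]
  choose H hH using hex
  have huniq : ∀ j g', IsHilbertTransform σ p (f j) g' → g' =ᵐ[volume] H j := fun j g' hg' => by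
    obtain ⟨c, hc⟩ := hg'.1.exists_approx
    refine hc.ae_eq hp (hH j) fun ξ => ?_
    rw [hg'.2 ξ, (hd j).fourierCoeff_smul hp1 (hH j), hilbertSymbol]
  refine ⟨fun j => ⟨H j, ⟨(hH j).mem, fun ξ => (hd j).fourierCoeff_smul hp1 (hH j) ξ⟩, huniq j⟩,
    fun g hg => ?_⟩
  refine stepNorm_squareFn_le hp0 (fun j => (hg j).1.1) fun N => ?_
  -- By uniqueness `g j` agrees a.e. with `H j`, so it has the same approximants.
  calc stepNorm p (partialSquareFn N g) ≤ K * stepNorm p (partialSquareFn N f) :=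
        stepNorm_partialSquareFn_le_of_approx hp1 N hd
          (fun j => (hH j).congr_ae hp0 (hg j).1.1 (huniq j _ (hg j)).symm)
          fun n => hK σ a N (fun j => d j n) hσ1 fun j ξ hξ => ha ξ (hdgap j n ξ hξ)
    _ ≤ K * stepNorm p (squareFn f) := by
        gcongr
        exact stepNorm_mono hp0 (.of_forall fun x => partialSquareFn_le_squareFn N f x)
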